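/- **Proposition (Generalized solution of the adjoint equation).** *Setting.* Let $T>0$, let $U\subseteq\mathbb R^m$ be the closure of a connected open set, let $A\subseteq\mathbb R^l$ be compact, and let $V\supseteq U$ be open and star-shaped about $0$. Let $\tilde f:\mathbb R^n\times V\times A\to\mathbb R^n$ be continuous in $a\in A$, of class $C^1$ in $(x,u)$, locally Lipschitz in $(x,u)$ uniformly in $a\in A$, and such that $|\tilde f(x,u,a)|\le M(1+|(x,u)|)$ on $\mathbb R^n\times U\times A$ for some $M>0$. Let $\tilde g_1,\dots,\tilde g_m:\mathbb R^n\times V\to\mathbb R^n$ be of class $C^2$, and put $f=(\tilde f,0)$, $g_\alpha=(\tilde g_\alpha,\mathbf e_\alpha)$, as vector fields with values in $\mathbb R^{n+m}$. Assume $[g_\alpha,g_\beta]=0$ on $\mathbb R^n\times V$ for all $\alpha,\beta$, and that for all $(x,z)\in\mathbb R^n\times V$ the integral curve of $-\sum_k z^kg_k$ ($z$ fixed) starting at $(x,z)$ exists on $[0,1]$; its endpoint is $\exp(-z^kg_k)(x,z)$. Let $\varphi(x,z)$ be the $x$-component of $\exp(-z^kg_k)(x,z)$, let $\phi(x,z)=(\varphi(x,z),z)$,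 and let $\phi^{-1}$ be the inverse of $\phi$ on $\phi(\mathbb R^n\times V)$. Let $\tilde F(\xi,\eta,a)$ be the $\mathbb R^n$-component of $\nabla\phi(x,z)f(x,z,a)$ at $(x,z)=\phi^{-1}(\xi,\eta)$. Let $\gamma:\mathbb R^{n+m}\to\mathbb R$ be of class $C^1$, and $\Psi=\gamma\circ\phi^{-1}$. Gradients and adjoint variables are row vectors. Let $x_0\in\mathbb R^n$ and let $u:[0,T]\to U$ and $a:[0,T]\to A$ be integrable. *Generalized solutions.* For $w\in C^1([0,T],U)$ consider the (Carathéodory) solutions on $[0,T]$ of $$(\dot x,\dot z)=f(x,z,a)+\sum_i\dot w^i g_i(x,z),\qquad (x,z)(0)=(x_0,w(0)),\tag{1}$$ $$\dot p=-p\cdot\Big(\nabla f(x,z,a)+\sum_i\dot w^i\nabla g_i(x,z)\Big),\qquad p(T)=\nabla\gamma(x(T),z(T)).\tag{2}$$ Let $I\subseteq[0,T]$ with $0\in I$. A pair $(x,z)$ with $z=u$ is a *generalized solution pointwise defined on $I$* if there are $w_k\in C^1([0,T],U)$ and solutions $(x_k,z_k)$ of (1) for $w=w_k$, with uniformly bounded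 values, such that $(x_k,z_k)\to(x,u)$ in $L^1(0,T)$ and at every point of $I$. If moreover $T\in I$, then $p$ is a *generalized solution of the adjoint equation along $(x,u)$ pointwise defined on $I$* if there are $w_k\in C^1([0,T],U)$ and solutions $(x_k,z_k,p_k)$ of (1)–(2) for $w=w_k$, with uniformly bounded values, such that $(x_k,z_k)\to(x,u)$ and $p_k\to p$ in $L^1(0,T)$ and at every point of $I$. Either one is called *pointwise defined everywhere* if for every $\tau\in[0,T]$ it is pointwise defined on $\{0,\tau,T\}$ (the approximating sequence may depend on $\tau$). *Statement.* Let $x:[0,T]\to\mathbb R^n$, put $(\xi,\eta)(t)=\phi(x(t),u(t))$, and let $\pi=(\pi_1,\pi_2)$ be a classical (absolutely continuous) solution of $$\dot\pi_1=-\pi_1\cdot\nabla_\xi\tilde F(\xi,\eta,a),\quad \dot\pi_2=-\pi_1\cdot\nabla_\eta\tilde F(\xi,\eta,a),\quad (\pi_1,\pi_2)(T)=\nabla\Psi(\xi(T),\eta(T)).$$ 1. If $(x,u)$ is a generalized solution pointwise defined everywhere, then a function $p$ is a generalized solution of the adjoint equation along $(x,u)$ pointwise defined everywhere if and only if $$p(t)=\pi(t)\cdot\nabla\phi(x(t),u(t))\qquad\text{for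 all }t\in[0,T].$$ 2. More generally, for each $I\subseteq[0,T]$ with $0,T\in I$: if $(x,u)$ is a generalized solution pointwise defined on $I$, then $p$ is a generalized solution of the adjoint equation along $(x,u)$ pointwise defined on $I$ if and only if $p(t)=\pi(t)\cdot\nabla\phi(x(t),u(t))$ for all $t\in I$ and for almost all $t\in[0,T]$. -/

import Mathlib

open Set Filter Topology MeasureTheory

noncomputable section

/-- Euclidean space of dimension `d`. -/
abbrev Vec (d : ℕ) : Type := EuclideanSpace ℝ (Fin d)

/-- The augmented state space with points `y = (x, z)`. -/
abbrev Aug (n m : ℕ) : Type := Vec n × Vec m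

/-- Row vectors on the augmented space; for a row vector `p` and a Jacobian `J`, the product
`p · J` is `p.comp J`, and the gradient (a row vector) of a scalar function is its `fderiv`. -/
abbrev Row (n m : ℕ) : Type := Aug n m →L[ℝ] ℝ

/-! ### Flows of vector fields -/

/-- `c` is an integral curve of the autonomous field `X` on `[0, 1]` that starts at `y`. -/
def IsUnitIntegralCurve {E : Type*} [NormedAddCommGroup E] [NormedSpace ℝ E]
    (X : E → E) (y : E) (c : ℝ → E) : Prop :=
  c 0 = y ∧ IsIntegralCurveOn c (fun _ => X) (Icc 0 1)

open Classical in
/-- `exp(X)(y)`: the value at time `1` of the integral curve of `X` that starts at `y`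
(and `y` itself if there is no such curve on `[0, 1]`). -/
def expField {E : Type*} [NormedAddCommGroup E] [NormedSpace ℝ E] (X : E → E) (y : E) : E :=
  if h : ∃ c : ℝ → E, IsUnitIntegralCurve X y c then h.choose 1 else y

/-! ### The impulsive system and the change of coordinates -/

/-- The augmented drift `f = (f̃, 0)` for a fixed value `a` of the ordinary control. -/
def driftField {n m l : ℕ} (f : Aug n m → Vec l → Vec n) (a : Vec l) (y : Aug n m) : Aug n m :=
  (f y a, 0)

/-- The augmented field `g_α = (g̃_α, e_α)`. -/
def gField {n m : ℕ} (g : Fin m → Aug n m → Vec n) (α : Fin m) (y : Aug n m) : Aug n m :=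
  (g α y, EuclideanSpace.single α 1)

/-- The field `- ∑ z^k g_k`, for constant coefficients `z`. -/
def negCombination {n m : ℕ} (g : Fin m → Aug n m → Vec n) (z : Vec m) (y : Aug n m) : Aug n m :=
  -∑ k, z k • gField g k y

/-- The change of coordinates `φ(x, z) = (ϕ(x, z), z)`, where `ϕ(x, z)` is the `x`-component of
`exp(- z^k g_k)(x, z)`. -/
def phi {n m : ℕ} (g : Fin m → Aug n m → Vec n) (y : Aug n m) : Aug n m :=
  ((expField (negCombination g y.2) y).1, y.2)

/-- The inverse of `φ`, taken on the domain `ℝⁿ × V` of the vector fields. -/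
def phiInv {n m : ℕ} (g : Fin m → Aug n m → Vec n) (V : Set (Vec m)) : Aug n m → Aug n m :=
  Function.invFunOn (phi g) (univ ×ˢ V)

/-- The first component `F̃` of the transformed drift: `F(ξ, η, a) = ∇φ(x, z) f(x, z, a)` at
`(ξ, η) = φ(x, z)`. -/
def Ftilde {n m l : ℕ} (f : Aug n m → Vec l → Vec n) (g : Fin m → Aug n m → Vec n)
    (V : Set (Vec m)) (y : Aug n m) (a : Vec l) : Vec n :=
  (fderiv ℝ (phi g) (phiInv g V y) (driftField f a (phiInv g V y))).1

/-- Standing assumptions. The fields live on `ℝⁿ × V` where `V ⊇ U` is open and star-shaped about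
the origin: this is what makes `exp(- z^k g_k)(x, z)`, whose integral curve runs over the
segment from `z` to `0`, and derivatives at boundary points of `U` meaningful. -/
structure StandingAssumptions {n m l : ℕ} (U V : Set (Vec m)) (A : Set (Vec l))
    (f : Aug n m → Vec l → Vec n) (g : Fin m → Aug n m → Vec n) : Prop where
  /-- `U` is the closure of a connected open set. -/
  closure_U : ∃ W : Set (Vec m), IsOpen W ∧ IsConnected W ∧ U = closure W
  isOpen_V : IsOpen V
  starConvex_V : StarConvex ℝ 0 V
  U_subset_V : U ⊆ V
  isCompact_A : IsCompact A
  /-- The drift is of class `C¹` in `(x, u)`. -/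
  f_contDiff : ∀ a ∈ A, ContDiffOn ℝ 1 (fun y => f y a) (univ ×ˢ V)
  /-- The drift is locally Lipschitz in `(x, u)`, uniformly in `a ∈ A`. -/
  f_lipschitz : ∀ y ∈ (univ : Set (Vec n)) ×ˢ V, ∃ L : NNReal, ∃ N ∈ 𝓝 y, ∀ a ∈ A,
    LipschitzOnWith L (fun y' => f y' a) N
  /-- The drift is continuous in `a`. -/
  f_continuous : ∀ y ∈ (univ : Set (Vec n)) ×ˢ V, ContinuousOn (f y) A
  /-- The drift has at most linear growth. -/
  f_growth : ∃ M : ℝ, 0 < M ∧ ∀ y ∈ (univ : Set (Vec n)) ×ˢ U, ∀ a ∈ A, ‖f y a‖ ≤ M * (1 + ‖y‖)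
  /-- The impulsive fields are of class `C²`. -/
  g_contDiff : ∀ α, ContDiffOn ℝ 2 (g α) (univ ×ˢ V)
  /-- The augmented impulsive fields commute. -/
  g_comm : ∀ α β, ∀ y ∈ (univ : Set (Vec n)) ×ˢ V,
    VectorField.lieBracket ℝ (gField g α) (gField g β) y = 0
  /-- `exp(- z^k g_k)(x, z)` is defined: the integral curve exists up to time `1`. -/
  exp_defined : ∀ y ∈ (univ : Set (Vec n)) ×ˢ V,
    ∃ c : ℝ → Aug n m, IsUnitIntegralCurve (negCombination g y.2) y c

/-! ### Classical solutions for controls of class `C¹` -/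

/-- `w ∈ C¹([0, T], U)`. -/
def IsC1Control {m : ℕ} (T : ℝ) (U : Set (Vec m)) (w : ℝ → Vec m) : Prop :=
  ContDiffOn ℝ 1 w (Icc 0 T) ∧ MapsTo w (Icc 0 T) U

/-- The right-hand side `f(x, z, a) + ∑ ẇ^i g_i(x, z)` along `y = (x, z)`. -/
def stateRHS {n m l : ℕ} (T : ℝ) (f : Aug n m → Vec l → Vec n) (g : Fin m → Aug n m → Vec n)
    (w : ℝ → Vec m) (a : ℝ → Vec l) (y : ℝ → Aug n m) (s : ℝ) : Aug n m :=
  driftField f (a s) (y s) + ∑ i, (derivWithin w (Icc 0 T) s) i • gField g i (y s)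

/-- `y = (x, z)` is the (absolutely continuous) solution on `[0, T]` of
`(ẋ, ż) = f(x, z, a) + ∑ ẇ^i g_i(x, z)`, `(x, z)(0) = (x₀, w(0))`. -/
def IsClassicalState {n m l : ℕ} (T : ℝ) (f : Aug n m → Vec l → Vec n)
    (g : Fin m → Aug n m → Vec n) (x₀ : Vec n) (w : ℝ → Vec m) (a : ℝ → Vec l)
    (y : ℝ → Aug n m) : Prop :=
  IntervalIntegrable (stateRHS T f g w a y) volume 0 T ∧
    ∀ t ∈ Icc 0 T, y t = (x₀, w 0) + ∫ s in 0..t, stateRHS T f g w a y s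

/-- The Jacobian `∇f(x, z, a) + ∑ ẇ^i ∇g_i(x, z)` along `y = (x, z)`. -/
def stateJacobian {n m l : ℕ} (T : ℝ) (f : Aug n m → Vec l → Vec n) (g : Fin m → Aug n m → Vec n)
    (w : ℝ → Vec m) (a : ℝ → Vec l) (y : ℝ → Aug n m) (s : ℝ) : Aug n m →L[ℝ] Aug n m :=
  fderiv ℝ (driftField f (a s)) (y s) +
    ∑ i, (derivWithin w (Icc 0 T) s) i • fderiv ℝ (gField g i) (y s)

/-- `p = (p₁, p₂)` is the (absolutely continuous) solution on `[0, T]` of the adjoint equation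
`ṗ = - p · (∇f + ∑ ẇ^i ∇g_i)`, `p(T) = ∇γ(x(T), z(T))`, along `y = (x, z)`. -/
def IsClassicalAdjoint {n m l : ℕ} (T : ℝ) (f : Aug n m → Vec l → Vec n)
    (g : Fin m → Aug n m → Vec n) (γ : Aug n m → ℝ) (w : ℝ → Vec m) (a : ℝ → Vec l)
    (y : ℝ → Aug n m) (p : ℝ → Row n m) : Prop :=
  p T = fderiv ℝ γ (y T) ∧
  IntervalIntegrable (fun s => (p s).comp (stateJacobian T f g w a y s)) volume 0 T ∧
    ∀ t ∈ Icc 0 T, p t = p T + ∫ s in t..T, (p s).comp (stateJacobian T f g w a y s)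

/-! ### Generalized solutions -/

/-- Convergence in `L¹_I`: convergence in `L¹(0, T)` to an integrable function, together with
convergence at every point of `I`. -/
def TendstoL1On {E : Type*} [NormedAddCommGroup E] (T : ℝ) (I : Set ℝ)
    (v : ℕ → ℝ → E) (v' : ℝ → E) : Prop :=
  IntegrableOn v' (Icc 0 T) ∧
  Tendsto (fun k => ∫⁻ t in Icc 0 T, ‖v k t - v' t‖ₑ) atTop (𝓝 0) ∧
  ∀ t ∈ I, Tendsto (fun k => v k t) atTop (𝓝 (v' t))

/-- The functions `v k` have uniformly bounded values on `[0, T]`. -/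
def UniformlyBounded {E : Type*} [NormedAddCommGroup E] (T : ℝ) (v : ℕ → ℝ → E) : Prop :=
  ∃ C : ℝ, ∀ k, ∀ t ∈ Icc 0 T, ‖v k t‖ ≤ C

/-- `(x, z = u)` is a generalized solution, pointwise defined on `I`, of the impulsive Cauchy
problem with input `(x₀, u, a)`. -/
def IsGeneralizedSolution {n m l : ℕ} (T : ℝ) (I : Set ℝ) (U : Set (Vec m))
    (f : Aug n m → Vec l → Vec n) (g : Fin m → Aug n m → Vec n) (x₀ : Vec n)
    (u : ℝ → Vec m) (a : ℝ → Vec l) (x : ℝ → Vec n) : Prop :=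
  ∃ (w : ℕ → ℝ → Vec m) (y : ℕ → ℝ → Aug n m),
    (∀ k, IsC1Control T U (w k)) ∧
    (∀ k, IsClassicalState T f g x₀ (w k) a (y k)) ∧
    UniformlyBounded T y ∧ TendstoL1On T I y (fun t => (x t, u t))

/-- `p` is, along the generalized solution `(x, z = u)`, a generalized solution, pointwise defined
on `I`, of the impulsive adjoint equation with `p(T) = ∇γ(x(T), u(T))`: the same limiting procedure,
applied to the coupled system for `((x, z), p)`. -/
def IsGeneralizedAdjoint {n m l : ℕ} (T : ℝ) (I : Set ℝ) (U : Set (Vec m))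
    (f : Aug n m → Vec l → Vec n) (g : Fin m → Aug n m → Vec n) (γ : Aug n m → ℝ) (x₀ : Vec n)
    (u : ℝ → Vec m) (a : ℝ → Vec l) (x : ℝ → Vec n) (p : ℝ → Row n m) : Prop :=
  ∃ (w : ℕ → ℝ → Vec m) (y : ℕ → ℝ → Aug n m) (q : ℕ → ℝ → Row n m),
    (∀ k, IsC1Control T U (w k)) ∧
    (∀ k, IsClassicalState T f g x₀ (w k) a (y k)) ∧
    (∀ k, IsClassicalAdjoint T f g γ (w k) a (y k) (q k)) ∧
    UniformlyBounded T y ∧ UniformlyBounded T q ∧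
    TendstoL1On T I y (fun t => (x t, u t)) ∧ TendstoL1On T I q p

/-- `(x, z = u)` is a generalized solution pointwise defined everywhere: the value at each time `τ`
is obtained from approximating controls (which may depend on `τ`) that converge in `L¹` and at the
times `0`, `τ` and `T`. -/
def IsGeneralizedSolutionEverywhere {n m l : ℕ} (T : ℝ) (U : Set (Vec m))
    (f : Aug n m → Vec l → Vec n) (g : Fin m → Aug n m → Vec n) (x₀ : Vec n)
    (u : ℝ → Vec m) (a : ℝ → Vec l) (x : ℝ → Vec n) : Prop :=
  ∀ τ ∈ Icc 0 T, IsGeneralizedSolution T {0, τ, T} U f g x₀ u a x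

/-- The adjoint counterpart of `IsGeneralizedSolutionEverywhere`. -/
def IsGeneralizedAdjointEverywhere {n m l : ℕ} (T : ℝ) (U : Set (Vec m))
    (f : Aug n m → Vec l → Vec n) (g : Fin m → Aug n m → Vec n) (γ : Aug n m → ℝ) (x₀ : Vec n)
    (u : ℝ → Vec m) (a : ℝ → Vec l) (x : ℝ → Vec n) (p : ℝ → Row n m) : Prop :=
  ∀ τ ∈ Icc 0 T, IsGeneralizedAdjoint T {0, τ, T} U f g γ x₀ u a x p

/-! ### The classical adjoint of the transformed system -/

/-- `(π₁, π₂)` is an (absolutely continuous) solution on `[0, T]`, along `(ξ, η)`, of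
`π̇₁ = - π₁ · ∇_ξ F̃(ξ, η, a)`, `π̇₂ = - π₁ · ∇_η F̃(ξ, η, a)`,
`(π₁, π₂)(T) = ∇Ψ(ξ(T), η(T))`, where `Ψ = γ ∘ φ⁻¹`. -/
def IsTransformedAdjoint {n m l : ℕ} (T : ℝ) (V : Set (Vec m))
    (f : Aug n m → Vec l → Vec n) (g : Fin m → Aug n m → Vec n) (γ : Aug n m → ℝ)
    (a : ℝ → Vec l) (ξ : ℝ → Vec n) (η : ℝ → Vec m)
    (π₁ : ℝ → (Vec n →L[ℝ] ℝ)) (π₂ : ℝ → (Vec m →L[ℝ] ℝ)) : Prop :=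
  (π₁ T).coprod (π₂ T) = fderiv ℝ (fun y => γ (phiInv g V y)) (ξ T, η T) ∧
  IntervalIntegrable
    (fun s => (π₁ s).comp (fderiv ℝ (fun ξ' => Ftilde f g V (ξ', η s) (a s)) (ξ s))) volume 0 T ∧
  IntervalIntegrable
    (fun s => (π₁ s).comp (fderiv ℝ (fun η' => Ftilde f g V (ξ s, η') (a s)) (η s))) volume 0 T ∧
  (∀ t ∈ Icc 0 T, π₁ t = π₁ T +
    ∫ s in t..T, (π₁ s).comp (fderiv ℝ (fun ξ' => Ftilde f g V (ξ', η s) (a s)) (ξ s))) ∧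
  (∀ t ∈ Icc 0 T, π₂ t = π₂ T +
    ∫ s in t..T, (π₁ s).comp (fderiv ℝ (fun η' => Ftilde f g V (ξ s, η') (a s)) (η s)))

end

/-! The map `φ` straightens the impulsive fields. Because the `g_α` commute, `∇φ · g_α = (0, e_α)`
(`fderiv_phi_gField`), so in the coordinates `φ(x, z)` the derivative `ẇ` no longer acts on the
first component. Differentiating this identity, together with `∇φ · f = (F̃, 0) ∘ φ`, expresses the
derivative of `∇φ` along the dynamics (`fderiv_fderiv_phi_dynamics`). The product rule then shows
that, for a control of class `C¹` with trajectory `y`, the classical adjoint is `p = π · ∇φ(y)`,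
where `π̇ = -π · ∇(F̃, 0)` (`isClassicalAdjoint_comp_fderiv_phi`). The control enters the equation
for `π` only through the values of `y`, never through `ẇ`.

This makes the passage to the limit harmless. Along an approximating sequence `y_k` the Jacobians of
`F̃` are uniformly bounded and converge in `L¹`, and the terminal values converge because `T ∈ I`.
Grönwall gives `π_k → π` uniformly, so `π_k · ∇φ(y_k)` converges in `L¹` and wherever `y_k` does
(`exists_adjoint_approximation`). Classical adjoints are unique, so every approximating sequence
produces this limit and no other, which is the equivalence.

Two technical points need care. The map `φ` must be `C²` with an invertible derivative; this is
smooth dependence of a flow on its initial point, obtained from the inverse function theorem on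
`C([0,1], E)`. Moreover `∇f` is not assumed continuous in `a`: its measurability along curves comes
from difference quotients, and its bounds from the Lipschitz constants that are uniform in `a`. -/

noncomputable section

/-! ### Integral inequalities and linear Volterra equations -/

/-- Backward Grönwall inequality in integral form. -/
theorem le_mul_exp_of_le_add_integral {v : ℝ → ℝ} {T C ε : ℝ} (hT : 0 ≤ T) (hC : 0 ≤ C)
    (hv : ContinuousOn v (Icc 0 T))
    (h : ∀ t ∈ Icc 0 T, v t ≤ ε + C * ∫ s in t..T, v s) :
    ∀ t ∈ Icc 0 T, v t ≤ ε * Real.exp (C * (T - t)) := by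
  -- Reversing time by `r = T - t` turns the tail integral into a function of `r` that vanishes at
  -- `0` and whose right derivative `v (T - r)` is at most `C` times itself plus `ε`.
  have key := le_gronwallBound_of_liminf_deriv_right_le
    (f := fun r => ∫ s in (T - r)..T, v s) (f' := fun r => v (T - r)) (δ := 0) (K := C) (ε := ε)
    (a := 0) (b := T) ?_ ?_ (by simp) ?_
  · intro t ht
    have h1 := key (T - t) ⟨by linarith [ht.2], by linarith [ht.1]⟩
    simp only [sub_sub_cancel, sub_zero] at h1
    refine (h t ht).trans ?_
    rcases eq_or_ne C 0 with rfl | hC0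
    · simp
    · rw [gronwallBound_of_K_ne_0 hC0] at h1
      calc ε + C * ∫ s in t..T, v s
          ≤ ε + C * (0 * Real.exp (C * (T - t)) + ε / C * (Real.exp (C * (T - t)) - 1)) := by
            gcongr
        _ = _ := by field_simp; ring
  · have h1 : ContinuousOn (fun r => ∫ s in T..r, v s) (Icc 0 T) := by
      have := intervalIntegral.continuousOn_primitive_interval' (μ := volume) (a := T) (b₁ := 0)
        (b₂ := T) (f := v) (hv.intervalIntegrable_of_Icc hT) right_mem_uIcc
      rwa [uIcc_of_le hT] at this
    have h2 : ContinuousOn (fun r => ∫ s in T..(T - r), v s) (Icc 0 T) :=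
      h1.comp (t := Icc 0 T) (f := fun r => T - r) (by fun_prop)
        fun r hr => ⟨by linarith [hr.2], by linarith [hr.1]⟩
    refine h2.neg.congr fun r _ => ?_
    simp only [Pi.neg_apply]
    rw [intervalIntegral.integral_symm]
  · intro r hr q hq
    have hr' : T - r ∈ Ioc 0 T := ⟨by linarith [hr.2], by linarith [hr.1]⟩
    have h1 : HasDerivWithinAt (fun x => ∫ s in x..T, v s) (-v (T - r)) (Iic (T - r)) (T - r) := by
      apply intervalIntegral.integral_hasDerivWithinAt_left
        ((hv.mono (by rw [uIcc_of_le hr'.2]; exact Icc_subset_Icc_left hr'.1.le)).intervalIntegrable)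
      · refine ⟨Ioc 0 (T - r), ?_, ?_⟩
        · exact Ioc_mem_nhdsLE hr'.1
        · exact (hv.mono (Ioc_subset_Icc_self.trans (Icc_subset_Icc_right hr'.2))).aestronglyMeasurable
            measurableSet_Ioc
      · exact (hv (T - r) (Ioc_subset_Icc_self hr')).mono_of_mem_nhdsWithin
          (mem_of_superset (Icc_mem_nhdsLE hr'.1) (Icc_subset_Icc_right hr'.2))
    have h2 : HasDerivWithinAt (fun x => ∫ s in (T - x)..T, v s) (v (T - r)) (Ici r) r := by
      have h3 : HasDerivWithinAt (fun x : ℝ => T - x) (-1) (Ici r) r :=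
        ((hasDerivAt_id r).const_sub T).hasDerivWithinAt
      have := HasDerivWithinAt.scomp r h1 h3 (fun x hx => by simp at hx ⊢; linarith)
      rwa [neg_one_smul, neg_neg] at this
    have h4 := h2.Ioi_of_Ici.limsup_slope_le' (by simp) hq
    refine (h4.mono fun z hz => ?_).frequently
    simpa [slope_def_field, div_eq_inv_mul] using hz
  · intro r hr
    have := h (T - r) ⟨by linarith [hr.2], by linarith [hr.1]⟩
    linarith

/-- Picard iteration in an exponentially weighted norm, which needs no smallness of `T`. The weight
is implemented by the substitution `h t = exp (l t) • k t`. Coefficients are only measurable, hence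
the integral form. -/
theorem exists_volterra_solution {E : Type*} [NormedAddCommGroup E] [NormedSpace ℝ E]
    [CompleteSpace E] {T C : ℝ} (hT : 0 ≤ T) {K : ℝ → E →L[ℝ] E} (hK : AEStronglyMeasurable K)
    (hC : ∀ s, ‖K s‖ ≤ C) {b : ℝ → E} (hb : ContinuousOn b (Icc 0 T)) :
    ∃ h : ℝ → E, Continuous h ∧ ∀ t ∈ Icc 0 T, h t = b t + ∫ s in 0..t, K s (h s) := by
  have hC0 : 0 ≤ C := (norm_nonneg _).trans (hC 0)
  -- The contraction factor will be `C / l ≤ 1 / 2`; the summand `1` keeps `l` positive when `C =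
  -- 0`.
  set l : ℝ := 2 * C + 1 with hl
  have hl0 : 0 < l := by positivity
  have hint : ∀ k : C(Icc 0 T, E), ∀ a b : ℝ, IntervalIntegrable
      (fun s => Real.exp (l * s) • K s (IccExtend hT k s)) volume a b := by
    intro k a b
    have h1 : Continuous fun s => Real.exp (l * s) := by fun_prop
    have h2 : Continuous (IccExtend hT k) := k.continuous.Icc_extend'
    have h3 : IntervalIntegrable K volume a b := by
      rw [intervalIntegrable_iff]
      exact Measure.integrableOn_of_bounded (M := C) (by simp) hK (ae_of_all _ hC)
    have h4 : IntervalIntegrable (fun s => K s (IccExtend hT k s)) volume a b := by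
      obtain ⟨D, hD⟩ := isCompact_uIcc.exists_bound_of_continuousOn (s := uIcc a b) h2.continuousOn
      rw [intervalIntegrable_iff] at h3 ⊢
      refine Integrable.mono' (h3.norm.mul_const D) ?_ ?_
      · exact (ContinuousLinearMap.apply ℝ E).flip.aestronglyMeasurable_comp₂ h3.1
          h2.aestronglyMeasurable
      · filter_upwards [ae_restrict_mem measurableSet_uIoc] with s hs
        exact ((K s).le_opNorm _).trans (by gcongr; exact hD s (uIoc_subset_uIcc hs))
    exact h4.continuousOn_smul h1.continuousOn
  let P : C(Icc 0 T, E) → C(Icc 0 T, E) := fun k =>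
    ⟨fun t => Real.exp (-(l * t)) • (b t + ∫ s in (0 : ℝ)..t, Real.exp (l * s) • K s (IccExtend hT k s)),
      ((by fun_prop : Continuous fun t : Icc 0 T => Real.exp (-(l * t))).smul
        ((continuousOn_iff_continuous_domRestrict.1 hb).add
        ((intervalIntegral.continuous_primitive (hint k) 0).comp continuous_subtype_val)))⟩
  have hP : ContractingWith (1 / 2 : NNReal) P := by
    refine ⟨by rw [← NNReal.coe_lt_coe]; norm_num, LipschitzWith.of_dist_le_mul fun k k' => ?_⟩
    rw [ContinuousMap.dist_le (by positivity)]
    intro t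
    have ht := t.2
    have e1 : P k t - P k' t = Real.exp (-(l * t)) •
        ∫ s in (0 : ℝ)..t, Real.exp (l * s) • K s (IccExtend hT k s - IccExtend hT k' s) := by
      change Real.exp (-(l * t)) • (_ : E) - Real.exp (-(l * t)) • (_ : E) = _
      rw [← smul_sub, add_sub_add_left_eq_sub, ← intervalIntegral.integral_sub (hint _ _ _) (hint _ _ _)]
      simp [smul_sub]
    rw [dist_eq_norm, e1, norm_smul, Real.norm_eq_abs, abs_of_pos (Real.exp_pos _)]
    have e2 : ‖∫ s in (0 : ℝ)..t, Real.exp (l * s) • K s (IccExtend hT k s - IccExtend hT k' s)‖ ≤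
        ∫ s in (0 : ℝ)..t, Real.exp (l * s) * (C * dist k k') := by
      apply intervalIntegral.norm_integral_le_of_norm_le ht.1
      · refine ae_of_all _ fun s _ => ?_
        rw [norm_smul, Real.norm_eq_abs, abs_of_pos (Real.exp_pos _)]
        gcongr
        refine ((K s).le_opNorm _).trans ?_
        gcongr
        · exact hC s
        · rw [← dist_eq_norm]; exact ContinuousMap.dist_apply_le_dist _
      · exact Continuous.intervalIntegrable (by fun_prop) _ _
    have e3 : ∫ s in (0 : ℝ)..t, Real.exp (l * s) * (C * dist k k') =
        (Real.exp (l * t) - 1) / l * (C * dist k k') := by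
      rw [intervalIntegral.integral_mul_const, intervalIntegral.integral_comp_mul_left _ hl0.ne',
        integral_exp]
      simp [div_eq_inv_mul]
    have e4 : Real.exp (-(l * t)) * Real.exp (l * t) = 1 := by
      rw [← Real.exp_add]; simp
    calc _ ≤ Real.exp (-(l * t)) * ((Real.exp (l * t) - 1) / l * (C * dist k k')) := by
            gcongr; exact e2.trans e3.le
      _ = (1 - Real.exp (-(l * t))) * (C / l * dist k k') := by
            have : Real.exp (-(l * t)) * (Real.exp (l * t) - 1) = 1 - Real.exp (-(l * t)) := by
              rw [mul_sub, e4, mul_one]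
            rw [← this]; ring
      _ ≤ 1 * (1 / 2 * dist k k') := by
            have h1 : C / l ≤ 1 / 2 := by rw [div_le_div_iff₀ hl0 two_pos]; linarith
            have h2 : 1 - Real.exp (-(l * t)) ≤ 1 := by linarith [Real.exp_pos (-(l * t))]
            exact mul_le_mul h2 (by gcongr) (by positivity) one_pos.le
      _ = _ := by simp
  obtain ⟨k, hk⟩ : ∃ k, P k = k := ⟨_, hP.fixedPoint_isFixedPt⟩
  refine ⟨fun t => Real.exp (l * t) • IccExtend hT k t, ?_, fun t ht => ?_⟩
  · exact (by fun_prop : Continuous fun t => Real.exp (l * t)).smul k.continuous.Icc_extend'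
  · have h1 : k ⟨t, ht⟩ = _ := (DFunLike.congr_fun hk ⟨t, ht⟩).symm
    beta_reduce
    rw [IccExtend_of_mem _ _ ht, h1]
    change _ • Real.exp (-(l * t)) • ((_ : E) + (_ : E)) = (_ : E)
    rw [smul_smul, ← Real.exp_add]
    simp

/-- Time reversal of the Volterra equation, with the coefficient extended by zero so that its bound
holds on the whole line. -/
theorem exists_backward_linear_solution {E : Type*} [NormedAddCommGroup E] [NormedSpace ℝ E]
    [CompleteSpace E] {T C : ℝ} (hT : 0 ≤ T) {K : ℝ → E →L[ℝ] E}
    (hK : AEStronglyMeasurable K (volume.restrict (Icc 0 T)))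
    (hC : ∀ s ∈ Icc 0 T, ‖K s‖ ≤ C) (b : E) :
    ∃ h : ℝ → E, Continuous h ∧ ∀ t ∈ Icc 0 T, h t = b + ∫ s in t..T, K s (h s) := by
  have hC0 : 0 ≤ C := (norm_nonneg _).trans (hC 0 ⟨le_rfl, hT⟩)
  set K' : ℝ → E →L[ℝ] E := (Icc 0 T).indicator K
  have hK' : AEStronglyMeasurable K' := (aestronglyMeasurable_indicator_iff measurableSet_Icc).2 hK
  have hm : MeasurePreserving (fun s : ℝ => T - s) := volume.measurePreserving_sub_left T
  obtain ⟨h, hc, hh⟩ := exists_volterra_solution (C := C) hT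
    (hK'.comp_quasiMeasurePreserving hm.quasiMeasurePreserving) (fun s => by
      simp only [Function.comp, K']
      by_cases hs : T - s ∈ Icc 0 T
      · rw [indicator_of_mem hs]; exact hC _ hs
      · rw [indicator_of_notMem hs]; simpa) (b := fun _ => b) continuousOn_const
  refine ⟨fun t => h (T - t), by fun_prop, fun t ht => ?_⟩
  have h1 := hh (T - t) ⟨by linarith [ht.2], by linarith [ht.1]⟩
  beta_reduce
  rw [h1]
  congr 1
  have := intervalIntegral.integral_comp_sub_left (a := t) (b := T) (fun s => K' (T - s) (h s)) T
  simp only [sub_sub_cancel, sub_self, Function.comp] at this ⊢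
  rw [← this]
  refine intervalIntegral.integral_congr fun s hs => ?_
  rw [uIcc_of_le ht.2] at hs
  simp only [K']
  rw [indicator_of_mem (show s ∈ Icc 0 T from ⟨ht.1.trans hs.1, hs.2⟩)]

/-! ### Composition operators on spaces of continuous maps -/

section CompositionOperators

universe v

variable {K : Type*} [TopologicalSpace K] [CompactSpace K]
  {E F : Type v} [NormedAddCommGroup E] [NormedSpace ℝ E] [NormedAddCommGroup F] [NormedSpace ℝ F]

/-- Pointwise application of a continuous family of operators to a continuous map. -/
def pointwiseApply (K : Type*) [TopologicalSpace K] [CompactSpace K]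
    (E F : Type*) [NormedAddCommGroup E] [NormedSpace ℝ E] [NormedAddCommGroup F]
    [NormedSpace ℝ F] : C(K, E →L[ℝ] F) →L[ℝ] C(K, E) →L[ℝ] C(K, F) :=
  LinearMap.mkContinuous₂
    (LinearMap.mk₂ ℝ (fun (A : C(K, E →L[ℝ] F)) (h : C(K, E)) => (⟨fun t => A t (h t), A.continuous.clm_apply h.continuous⟩ : C(K, F)))
      (fun A B h => by ext t; simp) (fun c A h => by ext t; simp)
      (fun A h k => by ext t; simp) (fun c A h => by ext t; simp)) 1
    (fun A h => by
      rw [one_mul, ContinuousMap.norm_le _ (by positivity)]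
      intro t
      exact ((A t).le_opNorm _).trans
        (mul_le_mul (A.norm_coe_le_norm t) (h.norm_coe_le_norm t) (norm_nonneg _) (by positivity)))

/-- Compactness of `K` makes `c ↦ X' ∘ c` continuous for uniform convergence. Hence `X'` varies by
at most `ε` on balls around the points `c t` whose radius does not depend on `t`, and the mean value
inequality gives a remainder that is uniform in `t`. -/
theorem hasFDerivAt_continuousMap_comp (X : C(E, F)) (hX : Differentiable ℝ X)
    (X' : C(E, E →L[ℝ] F)) (hX' : ∀ y, fderiv ℝ X y = X' y) (c : C(K, E)) :
    HasFDerivAt (fun c : C(K, E) => X.comp c) (pointwiseApply K E F (X'.comp c)) c := by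
  rw [hasFDerivAt_iff_isLittleO_nhds_zero, Asymptotics.isLittleO_iff]
  intro ε hε
  have hcont : Continuous fun h : C(K, E) => X'.comp (c + h) :=
    (ContinuousMap.continuous_postcomp X').comp (by fun_prop)
  have h1 : ∀ᶠ h : C(K, E) in 𝓝 0, dist (X'.comp (c + h)) (X'.comp (c + 0)) < ε :=
    Metric.tendsto_nhds.1 (hcont.tendsto 0) ε hε
  obtain ⟨δ, hδ, h2⟩ := Metric.eventually_nhds_iff.1 h1
  filter_upwards [Metric.ball_mem_nhds (0 : C(K, E)) hδ] with h hh
  rw [mem_ball_zero_iff] at hh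
  rw [ContinuousMap.norm_le _ (by positivity)]
  intro t
  have h3 : ∀ y ∈ Metric.ball (c t) δ, ‖fderiv ℝ X y - X' (c t)‖ ≤ ε := by
    intro y hy
    -- The constant perturbation `y - c t` carries `c t` to `y`, so the uniform estimate evaluated
    -- at `t` is the pointwise one.
    have := h2 (y := ContinuousMap.const K (y - c t)) (by
      rw [dist_zero_right]
      refine lt_of_le_of_lt ?_ (mem_ball_iff_norm.1 hy)
      rw [ContinuousMap.norm_le _ (norm_nonneg _)]
      simp)
    have h4 := (ContinuousMap.dist_apply_le_dist t).trans this.le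
    simpa [dist_eq_norm, hX'] using h4
  have h4 : c t + h t ∈ Metric.ball (c t) δ := by
    simpa using (h.norm_coe_le_norm t).trans_lt hh
  have h5 := (convex_ball (c t) δ).norm_image_sub_le_of_norm_fderiv_le'
    (fun y _ => hX y) h3 (Metric.mem_ball_self hδ) h4
  simp only [add_sub_cancel_left] at h5
  calc _ ≤ _ := h5
    _ ≤ _ := by gcongr; exact h.norm_coe_le_norm t

/-- The derivative is again a composition operator, with values in `E →L[ℝ] F`, so induction applies
with `F` varying. Both spaces live in one universe so that `E →L[ℝ] F` remains in it. -/
theorem contDiff_continuousMap_comp (n : ℕ) {F : Type v} [NormedAddCommGroup F] [NormedSpace ℝ F]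
    (X : C(E, F)) (hX : ContDiff ℝ n X) : ContDiff ℝ n fun c : C(K, E) => X.comp c := by
  induction n generalizing F with
  | zero => exact contDiff_zero.2 (ContinuousMap.continuous_postcomp X)
  | succ n ih =>
    push_cast at hX ⊢
    obtain ⟨X', hX', hXX'⟩ := contDiff_succ_iff_hasFDerivAt.1 hX
    exact contDiff_succ_iff_hasFDerivAt.2
      ⟨fun c => pointwiseApply K E F ((⟨X', hX'.continuous⟩ : C(E, E →L[ℝ] F)).comp c),
        ContDiff.comp (g := pointwiseApply K E F) (ContinuousLinearMap.contDiff _)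
          (ih ⟨X', hX'.continuous⟩ hX'), fun c =>
          hasFDerivAt_continuousMap_comp X (fun y => (hXX' y).differentiableAt) ⟨X', hX'.continuous⟩
            (fun y => (hXX' y).fderiv) c⟩

end CompositionOperators

/-! ### Differentiable dependence of flows on the initial point -/

/-- Multiplication by a bump function. Agreement on a neighbourhood of `S`, not just on `S`, makes
derivatives agree as well; compact support supplies a global Lipschitz constant. -/
theorem exists_contDiff_eqOn_nhdsSet {E F : Type*} [NormedAddCommGroup E] [NormedSpace ℝ E]
    [FiniteDimensional ℝ E] [NormedAddCommGroup F] [NormedSpace ℝ F] {n : ℕ} {Ω S : Set E}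
    (hΩ : IsOpen Ω) (hS : IsCompact S) (hSΩ : S ⊆ Ω) {X : E → F} (hX : ContDiffOn ℝ n X Ω) :
    ∃ Y : E → F, ContDiff ℝ n Y ∧ HasCompactSupport Y ∧ ∀ᶠ y in 𝓝ˢ S, Y y = X y := by
  obtain ⟨K, hK, hSK, hKΩ⟩ := exists_compact_between hS hΩ hSΩ
  obtain ⟨χ, h1, h0, -⟩ := exists_contMDiffMap_one_nhds_of_subset_interior (n := n)
    (modelWithCornersSelf ℝ E) hS.isClosed hSK
  have hχ : ContDiff ℝ n χ := χ.contMDiff.contDiff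
  refine ⟨fun y => χ y • X y, contDiff_iff_contDiffAt.2 fun y => ?_, ?_, ?_⟩
  · by_cases hy : y ∈ Ω
    · exact hχ.contDiffAt.smul (hX.contDiffAt (hΩ.mem_nhds hy))
    · have : (fun y => χ y • X y) =ᶠ[𝓝 y] fun _ => 0 := by
        filter_upwards [hK.isClosed.isOpen_compl.mem_nhds fun h => hy (hKΩ h)] with z hz
        rw [h0 z hz, zero_smul]
      exact contDiffAt_const.congr_of_eventuallyEq this
  · exact HasCompactSupport.intro hK fun y hy => by rw [h0 y hy, zero_smul]
  · filter_upwards [h1] with y hy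
    rw [hy, one_smul]

/-- Uniqueness of integral curves of `C¹` vector fields on an open set. -/
theorem eqOn_of_isIntegralCurveOn {E : Type*} [NormedAddCommGroup E] [NormedSpace ℝ E]
    [FiniteDimensional ℝ E] {Ω : Set E} (hΩ : IsOpen Ω) {X : E → E} (hX : ContDiffOn ℝ 1 X Ω)
    {c c' : ℝ → E} (hc : IsIntegralCurveOn c (fun _ => X) (Icc 0 1))
    (hc' : IsIntegralCurveOn c' (fun _ => X) (Icc 0 1)) (hcΩ : MapsTo c (Icc 0 1) Ω)
    (hcΩ' : MapsTo c' (Icc 0 1) Ω) (h : c 0 = c' 0 ∨ c 1 = c' 1) : EqOn c c' (Icc 0 1) := by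
  obtain ⟨Y, hY, hYc, hYX⟩ := exists_contDiff_eqOn_nhdsSet (n := 1) hΩ
    ((isCompact_Icc.image_of_continuousOn hc.continuousOn).union
      (isCompact_Icc.image_of_continuousOn hc'.continuousOn))
    (union_subset hcΩ.image_subset hcΩ'.image_subset) (by exact_mod_cast hX)
  have hYX := hYX.self_of_nhdsSet
  obtain ⟨L, hL⟩ := hY.lipschitzWith_of_hasCompactSupport hYc (by simp)
  have d : ∀ t ∈ Icc (0 : ℝ) 1, HasDerivWithinAt c (Y (c t)) (Icc 0 1) t := fun t ht => by
    rw [hYX _ (Or.inl (mem_image_of_mem _ ht))]; exact hc t ht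
  have d' : ∀ t ∈ Icc (0 : ℝ) 1, HasDerivWithinAt c' (Y (c' t)) (Icc 0 1) t := fun t ht => by
    rw [hYX _ (Or.inr (mem_image_of_mem _ ht))]; exact hc' t ht
  rcases h with h | h
  · exact ODE_solution_unique_of_mem_Icc_right (v := fun _ => Y) (s := fun _ => univ)
      (fun _ _ => hL.lipschitzOnWith) hc.continuousOn
      (fun t ht => (d t (Ico_subset_Icc_self ht)).mono_of_mem_nhdsWithin
        (mem_of_superset (Icc_mem_nhdsGE ht.2) (Icc_subset_Icc_left ht.1))) (fun _ _ => trivial)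
      hc'.continuousOn
      (fun t ht => (d' t (Ico_subset_Icc_self ht)).mono_of_mem_nhdsWithin
        (mem_of_superset (Icc_mem_nhdsGE ht.2) (Icc_subset_Icc_left ht.1))) (fun _ _ => trivial) h
  · exact ODE_solution_unique_of_mem_Icc_left (v := fun _ => Y) (s := fun _ => univ)
      (fun _ _ => hL.lipschitzOnWith) hc.continuousOn
      (fun t ht => (d t (Ioc_subset_Icc_self ht)).mono_of_mem_nhdsWithin
        (mem_of_superset (Icc_mem_nhdsLE ht.1) (Icc_subset_Icc_right ht.2))) (fun _ _ => trivial)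
      hc'.continuousOn
      (fun t ht => (d' t (Ioc_subset_Icc_self ht)).mono_of_mem_nhdsWithin
        (mem_of_superset (Icc_mem_nhdsLE ht.1) (Icc_subset_Icc_right ht.2))) (fun _ _ => trivial) h

section Flow

universe v

variable {E : Type v} [NormedAddCommGroup E] [NormedSpace ℝ E]

/-- The primitive from `0` of a continuous map on the unit interval. -/
def primitiveCLM (E : Type*) [NormedAddCommGroup E] [NormedSpace ℝ E] :
    C(unitInterval, E) →L[ℝ] C(unitInterval, E) :=
  LinearMap.mkContinuous
    { toFun := fun c => ⟨fun t => ∫ s in (0 : ℝ)..t, IccExtend zero_le_one c s,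
        (intervalIntegral.continuous_primitive
          (fun _ _ => c.continuous.Icc_extend'.intervalIntegrable _ _) 0).comp continuous_subtype_val⟩
      map_add' := fun c d => by
        ext t
        change ∫ s in (0 : ℝ)..t, (IccExtend zero_le_one c s + IccExtend zero_le_one d s) = _
        exact intervalIntegral.integral_add (c.continuous.Icc_extend'.intervalIntegrable _ _)
          (d.continuous.Icc_extend'.intervalIntegrable _ _)
      map_smul' := fun r c => by
        ext t
        change ∫ s in (0 : ℝ)..t, r • IccExtend zero_le_one c s = _
        exact intervalIntegral.integral_smul _ _ } 1
    (fun c => by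
      rw [one_mul, ContinuousMap.norm_le _ (norm_nonneg _)]
      intro t
      refine (intervalIntegral.norm_integral_le_of_norm_le_const (C := ‖c‖)
        fun s _ => c.norm_coe_le_norm _).trans ?_
      rw [sub_zero, abs_of_nonneg t.2.1]
      exact mul_le_of_le_one_right (norm_nonneg _) t.2.2)

variable [CompleteSpace E]

/-- A Volterra equation of the second kind: the kernel is trivial by Grönwall, and a solution exists
for every right-hand side by `exists_volterra_solution`. -/
theorem bijective_one_sub_primitiveCLM (k : C(unitInterval, E →L[ℝ] E)) :
    Function.Bijective (ContinuousLinearMap.id ℝ C(unitInterval, E) -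
      (primitiveCLM E).comp (pointwiseApply unitInterval E E k)) := by
  constructor
  · rw [injective_iff_map_eq_zero]
    intro h hh
    have h0 : ∀ t : unitInterval,
        h t = ∫ s in (0 : ℝ)..t, k (projIcc 0 1 zero_le_one s) (IccExtend zero_le_one h s) :=
      fun t => sub_eq_zero.1 (DFunLike.congr_fun hh t)
    have hc : Continuous (IccExtend (zero_le_one' ℝ) h) := h.continuous.Icc_extend'
    -- The integral runs from `0`, whereas the Grönwall lemma is backward, so time is reversed.
    have h1 := le_mul_exp_of_le_add_integral (v := fun t => ‖IccExtend (zero_le_one' ℝ) h (1 - t)‖)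
      (T := 1) (C := ‖k‖) (ε := 0) zero_le_one (by positivity) (by fun_prop) (fun t ht => by
        have ht' : 1 - t ∈ Icc (0 : ℝ) 1 := ⟨by linarith [ht.2], by linarith [ht.1]⟩
        rw [IccExtend_of_mem _ _ ht', h0, zero_add]
        have e := intervalIntegral.integral_comp_sub_left (a := t) (b := 1)
          (fun s => ‖IccExtend (zero_le_one' ℝ) h s‖) 1
        rw [e, sub_self, ← intervalIntegral.integral_const_mul]
        refine intervalIntegral.norm_integral_le_of_norm_le ht'.1 (ae_of_all _ fun s _ => ?_)
          ((continuous_const.mul hc.norm).intervalIntegrable _ _)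
        exact ((k _).le_opNorm _).trans (by gcongr; exact k.norm_coe_le_norm _))
    ext t
    have h2 := h1 (1 - t) ⟨by linarith [t.2.2], by linarith [t.2.1]⟩
    rw [zero_mul, sub_sub_cancel, IccExtend_of_mem _ _ t.2] at h2
    exact norm_le_zero_iff.1 h2
  · intro b
    obtain ⟨h, hc, hh⟩ := exists_volterra_solution (T := 1) (C := ‖k‖) zero_le_one
      (K := fun s => k (projIcc 0 1 zero_le_one s))
      (k.continuous.comp continuous_projIcc).aestronglyMeasurable (fun s => k.norm_coe_le_norm _)
      (b := IccExtend (zero_le_one' ℝ) b) b.continuous.Icc_extend'.continuousOn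
    refine ⟨⟨fun t => h t, by fun_prop⟩, ?_⟩
    ext t
    change h t - ∫ s in (0 : ℝ)..t, k (projIcc 0 1 zero_le_one s) (h (projIcc 0 1 zero_le_one s)) = _
    rw [hh t t.2, IccExtend_of_mem _ _ t.2, sub_eq_iff_eq_add]
    congr 1
    refine intervalIntegral.integral_congr fun s hs => ?_
    rw [uIcc_of_le t.2.1] at hs
    have hs' : s ∈ Icc (0 : ℝ) 1 := ⟨hs.1, hs.2.trans t.2.2⟩
    rw [projIcc_of_mem _ hs']

/-- The solution of `c' = X(c)` on the unit interval depends smoothly on the initial point, near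
any initial point from which a solution exists; its derivative solves the linearized equation. -/
theorem exists_contDiffAt_integral_equation {n : ℕ} (hn : n ≠ 0) {X : E → E} (hX : ContDiff ℝ n X)
    {y₀ : E} {c₀ : C(unitInterval, E)}
    (h₀ : ∀ t : unitInterval, c₀ t = y₀ + ∫ s in (0 : ℝ)..t, X (IccExtend zero_le_one c₀ s)) :
    ∃ F : E → C(unitInterval, E), ContDiffAt ℝ n F y₀ ∧ F y₀ = c₀ ∧
      (∀ᶠ y in 𝓝 y₀, ∀ t : unitInterval,
        F y t = y + ∫ s in (0 : ℝ)..t, X (IccExtend zero_le_one (F y) s)) ∧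
      ∀ (v : E) (t : unitInterval), fderiv ℝ F y₀ v t = v + ∫ s in (0 : ℝ)..t,
        fderiv ℝ X (IccExtend zero_le_one c₀ s) (IccExtend zero_le_one (fderiv ℝ F y₀ v) s) := by
  have hn' : (n : WithTop ℕ∞) ≠ 0 := by exact_mod_cast hn
  have hX1 : ContDiff ℝ 1 X := hX.of_le (by exact_mod_cast Nat.one_le_iff_ne_zero.2 hn)
  let XC : C(E, E) := ⟨X, hX.continuous⟩
  let DX : C(E, E →L[ℝ] E) := ⟨fderiv ℝ X, hX1.continuous_fderiv one_ne_zero⟩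
  -- A curve `c` solves the integral equation from `y` exactly when `Θ c` is the constant `y`. The
  -- derivative of `Θ` at `c₀` is invertible, so the solution map is a local inverse of `Θ`
  -- restricted to constants.
  let Θ : C(unitInterval, E) → C(unitInterval, E) := fun c => c - primitiveCLM E (XC.comp c)
  let k : C(unitInterval, E →L[ℝ] E) := DX.comp c₀
  let D : C(unitInterval, E) ≃L[ℝ] C(unitInterval, E) :=
    ContinuousLinearEquiv.ofBijective _ (LinearMap.ker_eq_bot.2 (bijective_one_sub_primitiveCLM k).1)
      (LinearMap.range_eq_top.2 (bijective_one_sub_primitiveCLM k).2)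
  have hΘ : ContDiff ℝ n Θ :=
    contDiff_id.sub (ContDiff.comp (g := primitiveCLM E) (ContinuousLinearMap.contDiff _)
      (contDiff_continuousMap_comp n XC hX))
  have hD : HasFDerivAt Θ (D : C(unitInterval, E) →L[ℝ] C(unitInterval, E)) c₀ :=
    (hasFDerivAt_id c₀).sub ((primitiveCLM E).hasFDerivAt.comp c₀
      (hasFDerivAt_continuousMap_comp XC (hX1.differentiable one_ne_zero) DX (fun _ => rfl) c₀))
  let κ : E →L[ℝ] C(unitInterval, E) := ContinuousLinearMap.const ℝ unitInterval
  have hκ : Θ c₀ = κ y₀ := by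
    ext t
    exact sub_eq_iff_eq_add.2 (h₀ t)
  let G := hΘ.contDiffAt.localInverse hD hn'
  have hG : ContDiffAt ℝ n G (κ y₀) := hκ ▸ hΘ.contDiffAt.to_localInverse hD hn'
  have hF : ContDiffAt ℝ n (fun y => G (κ y)) y₀ := hG.comp y₀ κ.contDiff.contDiffAt
  have hF0 : G (κ y₀) = c₀ := hκ ▸ hΘ.contDiffAt.localInverse_apply_image hD hn'
  have hev : ∀ᶠ y in 𝓝 y₀, Θ (G (κ y)) = κ y := by
    have h1 : ∀ᶠ c in 𝓝 (κ y₀), Θ (G c) = c := by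
      rw [← hκ]
      exact (hΘ.contDiffAt.hasStrictFDerivAt' hD hn').eventually_right_inverse
    exact κ.continuous.continuousAt.eventually h1
  refine ⟨fun y => G (κ y), hF, hF0, ?_, ?_⟩
  · filter_upwards [hev] with y hy t
    exact sub_eq_iff_eq_add.1 (DFunLike.congr_fun hy t)
  · intro v t
    have h1 : HasFDerivAt (fun y => G (κ y)) (fderiv ℝ (fun y => G (κ y)) y₀) y₀ :=
      (hF.differentiableAt hn').hasFDerivAt
    -- Differentiating `Θ (F y) = κ y` at `y₀` is the linearized equation.
    have h2 := (HasFDerivAt.comp (g := Θ) y₀ (by rw [hF0]; exact hD) h1).congr_of_eventuallyEq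
      (f₁ := κ) (hev.mono fun y hy => hy.symm)
    have h3 := DFunLike.congr_fun (DFunLike.congr_fun (h2.unique κ.hasFDerivAt) v) t
    exact sub_eq_iff_eq_add.1 h3

theorem hasDerivWithinAt_of_eq_add_integral {f g : ℝ → E} {e : E} {a b : ℝ} (hg : Continuous g)
    (h : ∀ t ∈ Icc a b, f t = e + ∫ s in a..t, g s) :
    ∀ t ∈ Icc a b, HasDerivWithinAt f (g t) (Icc a b) t := fun t ht =>
  ((hg.integral_hasStrictDerivAt a t).hasDerivAt.const_add e).hasDerivWithinAt.congr h (h t ht)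

/-- Smooth dependence on the initial point, for a vector field on an open set. -/
theorem exists_contDiffAt_flow [FiniteDimensional ℝ E] {n : ℕ} (hn : n ≠ 0) {Ω : Set E}
    (hΩ : IsOpen Ω) {X : E → E} (hX : ContDiffOn ℝ n X Ω) {c : ℝ → E}
    (hc : IsIntegralCurveOn c (fun _ => X) (Icc 0 1)) (hcΩ : MapsTo c (Icc 0 1) Ω) :
    ∃ F : E → C(unitInterval, E), ContDiffAt ℝ n F (c 0) ∧
      (∀ᶠ y in 𝓝 (c 0), IsUnitIntegralCurve X y (IccExtend zero_le_one (F y)) ∧ ∀ t, F y t ∈ Ω) ∧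
      ∀ v : E, ∃ h : ℝ → E, h 0 = v ∧ h 1 = fderiv ℝ F (c 0) v 1 ∧
        ∀ t ∈ Icc (0 : ℝ) 1, HasDerivWithinAt h (fderiv ℝ X (c t) (h t)) (Icc 0 1) t := by
  have hS : IsCompact (c '' Icc 0 1) := isCompact_Icc.image_of_continuousOn hc.continuousOn
  obtain ⟨Y, hY, -, hYX⟩ := exists_contDiff_eqOn_nhdsSet hΩ hS hcΩ.image_subset hX
  have hYX' := hYX.self_of_nhdsSet
  rw [eventually_nhdsSet_iff_exists] at hYX
  obtain ⟨O, hO, hSO, hOY⟩ := hYX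
  let c₀ : C(unitInterval, E) := ⟨fun t => c t, continuousOn_iff_continuous_domRestrict.1 hc.continuousOn⟩
  have hc₀ : ∀ t ∈ Icc (0 : ℝ) 1, IccExtend zero_le_one c₀ t = c t := fun t ht =>
    IccExtend_of_mem _ _ ht
  have hYc : Continuous fun s => Y (IccExtend (zero_le_one' ℝ) c₀ s) :=
    hY.continuous.comp c₀.continuous.Icc_extend'
  have h₀ : ∀ t : unitInterval, c₀ t = c 0 + ∫ s in (0 : ℝ)..t, Y (IccExtend zero_le_one c₀ s) := by
    intro t
    have hsub : Icc 0 (t : ℝ) ⊆ Icc 0 1 := Icc_subset_Icc_right t.2.2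
    have := intervalIntegral.integral_eq_sub_of_hasDeriv_right_of_le t.2.1
      (hc.continuousOn.mono hsub) (f' := fun s => Y (IccExtend (zero_le_one' ℝ) c₀ s)) (fun s hs => by
        have hs' := hsub (Ioo_subset_Icc_self hs)
        rw [hc₀ s hs', hYX' _ (mem_image_of_mem _ hs')]
        exact ((hc s hs').hasDerivAt (Icc_mem_nhds hs.1 (hs.2.trans_le t.2.2))).hasDerivWithinAt)
      (hYc.intervalIntegrable _ _)
    rw [this]
    exact (add_sub_cancel _ _).symm
  obtain ⟨F, hF, hF0, hFe, hF'⟩ := exists_contDiffAt_integral_equation hn hY h₀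
  refine ⟨F, hF, ?_, fun v => ⟨IccExtend (zero_le_one' ℝ) (fderiv ℝ F (c 0) v), ?_, ?_, ?_⟩⟩
  -- Curves near `c₀` in the sup norm stay in the open set where `Y` and `X` agree, so they are
  -- integral curves of `X` itself.
  · have hopen : ∀ᶠ y in 𝓝 (c 0), ∀ t, F y t ∈ O ∩ Ω := by
      have h1 : {d : C(unitInterval, E) | MapsTo d univ (O ∩ Ω)} ∈ 𝓝 (F (c 0)) :=
        (ContinuousMap.isOpen_setOfPred_mapsTo isCompact_univ (hO.inter hΩ)).mem_nhds (by
          rw [hF0]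
          exact fun t _ => ⟨hSO (mem_image_of_mem _ t.2), hcΩ t.2⟩)
      filter_upwards [hF.continuousAt.eventually_mem h1] with y hy t using hy (mem_univ t)
    filter_upwards [hFe, hopen] with y hy hyO
    refine ⟨⟨?_, ?_⟩, fun t => (hyO t).2⟩
    · have := hy 0
      simpa using this
    · intro t ht
      have hYF : Continuous fun s => Y (IccExtend (zero_le_one' ℝ) (F y) s) :=
        hY.continuous.comp (F y).continuous.Icc_extend'
      have h1 := hasDerivWithinAt_of_eq_add_integral (f := IccExtend (zero_le_one' ℝ) (F y)) hYF
        (fun t ht => by rw [IccExtend_of_mem _ _ ht]; exact hy ⟨t, ht⟩) t ht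
      rwa [hOY (IccExtend _ (F y) t) (hyO _).1] at h1
  · have := hF' v 0
    simpa using this
  · exact IccExtend_of_mem _ _ (right_mem_Icc.2 zero_le_one)
  · intro t ht
    have hcont : Continuous fun s => fderiv ℝ Y (IccExtend (zero_le_one' ℝ) c₀ s)
        (IccExtend (zero_le_one' ℝ) (fderiv ℝ F (c 0) v) s) :=
      ((hY.continuous_fderiv (by exact_mod_cast hn)).comp c₀.continuous.Icc_extend').clm_apply
        (fderiv ℝ F (c 0) v).continuous.Icc_extend'
    have h1 := hasDerivWithinAt_of_eq_add_integral
      (f := IccExtend (zero_le_one' ℝ) (fderiv ℝ F (c 0) v)) hcont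
      (fun t ht => by rw [IccExtend_of_mem _ _ ht]; exact hF' v ⟨t, ht⟩) t ht
    have h2 : fderiv ℝ Y (c t) = fderiv ℝ X (c t) :=
      Filter.EventuallyEq.fderiv_eq (mem_of_superset
        (hO.mem_nhds (hSO (mem_image_of_mem _ ht))) hOY)
    rwa [hc₀ t ht, h2] at h1

end Flow

/-- Uniqueness for linear equations with bounded coefficients on the unit interval. -/
theorem eqOn_of_hasDerivWithinAt_linear {E : Type*} [NormedAddCommGroup E] [NormedSpace ℝ E]
    {A : ℝ → E →L[ℝ] E} {C : ℝ} (hA : ∀ t ∈ Icc (0 : ℝ) 1, ‖A t‖ ≤ C) {h h' : ℝ → E}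
    (hh : ∀ t ∈ Icc (0 : ℝ) 1, HasDerivWithinAt h (A t (h t)) (Icc 0 1) t)
    (hh' : ∀ t ∈ Icc (0 : ℝ) 1, HasDerivWithinAt h' (A t (h' t)) (Icc 0 1) t)
    (he : h 0 = h' 0 ∨ h 1 = h' 1) : EqOn h h' (Icc 0 1) := by
  have hL : ∀ t ∈ Icc (0 : ℝ) 1, LipschitzOnWith C.toNNReal (fun y => A t y) univ := fun t ht =>
    ((A t).lipschitz.weaken (by
      rw [← NNReal.coe_le_coe, coe_nnnorm]
      exact (hA t ht).trans (Real.le_coe_toNNReal C))).lipschitzOnWith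
  have hc : ContinuousOn h (Icc 0 1) := fun t ht => (hh t ht).continuousWithinAt
  have hc' : ContinuousOn h' (Icc 0 1) := fun t ht => (hh' t ht).continuousWithinAt
  rcases he with he | he
  · exact ODE_solution_unique_of_mem_Icc_right (v := fun t y => A t y) (s := fun _ => univ)
      (fun t ht => hL t (Ico_subset_Icc_self ht)) hc
      (fun t ht => (hh t (Ico_subset_Icc_self ht)).mono_of_mem_nhdsWithin
        (mem_of_superset (Icc_mem_nhdsGE ht.2) (Icc_subset_Icc_left ht.1))) (fun _ _ => trivial) hc'
      (fun t ht => (hh' t (Ico_subset_Icc_self ht)).mono_of_mem_nhdsWithin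
        (mem_of_superset (Icc_mem_nhdsGE ht.2) (Icc_subset_Icc_left ht.1))) (fun _ _ => trivial) he
  · exact ODE_solution_unique_of_mem_Icc_left (v := fun t y => A t y) (s := fun _ => univ)
      (fun t ht => hL t (Ioc_subset_Icc_self ht)) hc
      (fun t ht => (hh t (Ioc_subset_Icc_self ht)).mono_of_mem_nhdsWithin
        (mem_of_superset (Icc_mem_nhdsLE ht.1) (Icc_subset_Icc_right ht.2))) (fun _ _ => trivial) hc'
      (fun t ht => (hh' t (Ioc_subset_Icc_self ht)).mono_of_mem_nhdsWithin
        (mem_of_superset (Icc_mem_nhdsLE ht.1) (Icc_subset_Icc_right ht.2))) (fun _ _ => trivial) he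

theorem eq_left_of_hasDerivWithinAt_const {E : Type*} [NormedAddCommGroup E] [NormedSpace ℝ E]
    {h : ℝ → E} {e : E} (hh : ∀ t ∈ Icc (0 : ℝ) 1, HasDerivWithinAt h e (Icc 0 1) t) :
    ∀ t ∈ Icc (0 : ℝ) 1, h t = h 0 + t • e := by
  intro t ht
  have h1 := constant_of_derivWithin_zero (f := fun t => h t - t • e) (a := 0) (b := 1)
    (fun t ht => ((hh t ht).sub
      ((hasDerivWithinAt_id t _).smul_const e)).differentiableWithinAt)
    (fun t ht => by
      have := ((hh t (Ico_subset_Icc_self ht)).sub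
        ((hasDerivWithinAt_id t _).smul_const e)).derivWithin
        (uniqueDiffOn_Icc zero_lt_one t (Ico_subset_Icc_self ht))
      simpa using! this) t ht
  simp only [zero_smul, sub_zero] at h1
  rw [← h1, sub_add_cancel]

/-! ### The change of coordinates -/

section ChangeOfCoordinates

variable {n m l : ℕ}

/-- The field `∑ v^k g_k`, for constant coefficients `v`. -/
def controlField (g : Fin m → Aug n m → Vec n) (v : Vec m) (y : Aug n m) : Aug n m :=
  ∑ k, v k • gField g k y

theorem negCombination_eq (g : Fin m → Aug n m → Vec n) (z : Vec m) :
    negCombination g z = fun y => -controlField g z y := rfl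

theorem controlField_snd (g : Fin m → Aug n m → Vec n) (v : Vec m) (y : Aug n m) :
    (controlField g v y).2 = v := by
  simp only [controlField, Prod.snd_sum, Prod.smul_snd, gField]
  ext i
  simp [Pi.single_apply]

/-- The field of `negCombination`, with its coefficients adjoined as constant state variables. -/
def extendedField (g : Fin m → Aug n m → Vec n) (Y : Aug n m × Vec m) : Aug n m × Vec m :=
  (negCombination g Y.2 Y.1, 0)

variable {U V : Set (Vec m)} {A : Set (Vec l)} {f : Aug n m → Vec l → Vec n}
  {g : Fin m → Aug n m → Vec n}

namespace StandingAssumptions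

theorem isOpen_domain (h : StandingAssumptions U V A f g) :
    IsOpen ((univ : Set (Vec n)) ×ˢ V) := isOpen_univ.prod h.isOpen_V

theorem contDiffOn_gField (h : StandingAssumptions U V A f g) (α : Fin m) :
    ContDiffOn ℝ 2 (gField g α) (univ ×ˢ V) :=
  (h.g_contDiff α).prodMk contDiffOn_const

theorem hasFDerivAt_gField (h : StandingAssumptions U V A f g) (α : Fin m) {y : Aug n m}
    (hy : y ∈ (univ : Set (Vec n)) ×ˢ V) : HasFDerivAt (gField g α) (fderiv ℝ (gField g α) y) y :=
  (((h.contDiffOn_gField α).contDiffAt (h.isOpen_domain.mem_nhds hy)).differentiableAt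
    two_ne_zero).hasFDerivAt

theorem contDiffOn_negCombination (h : StandingAssumptions U V A f g) (z : Vec m) :
    ContDiffOn ℝ 2 (negCombination g z) (univ ×ˢ V) := by
  have h1 : ContDiffOn ℝ 2 (fun y => ∑ k, z k • gField g k y) (univ ×ˢ V) :=
    ContDiffOn.sum fun k _ => (h.contDiffOn_gField k).const_smul (z k)
  exact h1.neg

theorem contDiffOn_extendedField (h : StandingAssumptions U V A f g) :
    ContDiffOn ℝ 2 (extendedField g) (((univ : Set (Vec n)) ×ˢ V) ×ˢ univ) := by
  have h1 : ∀ k, ContDiffOn ℝ 2 (fun Y : Aug n m × Vec m => Y.2 k • gField g k Y.1)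
      (((univ : Set (Vec n)) ×ˢ V) ×ˢ univ) := fun k =>
    ContDiffOn.fun_smul ((EuclideanSpace.proj (𝕜 := ℝ) k).contDiff.comp contDiff_snd).contDiffOn
      ((h.contDiffOn_gField k).comp contDiff_fst.contDiffOn fun Y hY => hY.1)
  exact (ContDiffOn.sum (s := Finset.univ) fun k _ => h1 k).neg.prodMk contDiffOn_const

theorem fderiv_extendedField (h : StandingAssumptions U V A f g) {y : Aug n m}
    (hy : y ∈ (univ : Set (Vec n)) ×ˢ V) (z : Vec m) (w : Aug n m) (v : Vec m) :
    fderiv ℝ (extendedField g) (y, z) (w, v) =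
      (-∑ k, (z k • fderiv ℝ (gField g k) y w + v k • gField g k y), 0) := by
  have h1 : ∀ k, HasFDerivAt (fun Y : Aug n m × Vec m => Y.2 k • gField g k Y.1) _ (y, z) :=
    fun k => HasFDerivAt.fun_smul
      ((EuclideanSpace.proj (𝕜 := ℝ) k).hasFDerivAt.comp (y, z) (hasFDerivAt_snd (p := (y, z))))
      (HasFDerivAt.comp (g := gField g k) (y, z) (h.hasFDerivAt_gField k hy)
        (hasFDerivAt_fst (p := (y, z))))
  have h2 := ((HasFDerivAt.fun_sum fun k (_ : k ∈ Finset.univ) => h1 k).fun_neg.prodMk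
    (hasFDerivAt_const (0 : Vec m) (y, z))).fderiv
  have h3 : extendedField g = fun Y => (-∑ k, Y.2 k • gField g k Y.1, 0) := rfl
  rw [h3, h2]
  simp

/-- The second component moves with constant velocity `-z`, hence along the segment from `z` to `0`,
which lies in the star-shaped set `V`. -/
theorem mapsTo_domain (h : StandingAssumptions U V A f g) {y : Aug n m}
    (hy : y ∈ (univ : Set (Vec n)) ×ˢ V) {c : ℝ → Aug n m}
    (hc : IsUnitIntegralCurve (negCombination g y.2) y c) :
    (∀ t ∈ Icc (0 : ℝ) 1, (c t).2 = (1 - t) • y.2) ∧ MapsTo c (Icc 0 1) (univ ×ˢ V) := by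
  have h1 : ∀ t ∈ Icc (0 : ℝ) 1, (c t).2 = (1 - t) • y.2 := by
    intro t ht
    have := eq_left_of_hasDerivWithinAt_const (h := fun t => (c t).2) (e := -y.2) (fun t ht => by
      have h2 := (hasFDerivAt_snd (p := c t)).comp_hasDerivWithinAt t (hc.2 t ht)
      simpa [negCombination_eq, controlField_snd] using! h2) t ht
    rw [this, hc.1]
    module
  refine ⟨h1, fun t ht => ⟨trivial, ?_⟩⟩
  rw [h1 t ht]
  exact h.starConvex_V.smul_mem hy.2 (by linarith [ht.2]) (by linarith [ht.1])

theorem expField_eq (h : StandingAssumptions U V A f g) {y : Aug n m}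
    (hy : y ∈ (univ : Set (Vec n)) ×ˢ V) {c : ℝ → Aug n m}
    (hc : IsUnitIntegralCurve (negCombination g y.2) y c) :
    expField (negCombination g y.2) y = c 1 := by
  have hex : ∃ c : ℝ → Aug n m, IsUnitIntegralCurve (negCombination g y.2) y c := ⟨c, hc⟩
  rw [expField, dif_pos hex]
  exact eqOn_of_isIntegralCurveOn h.isOpen_domain
    ((h.contDiffOn_negCombination y.2).of_le one_le_two) hex.choose_spec.2 hc.2
    (h.mapsTo_domain hy hex.choose_spec).2 (h.mapsTo_domain hy hc).2
    (Or.inl (hex.choose_spec.1.trans hc.1.symm)) (right_mem_Icc.2 zero_le_one)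

theorem expField_snd (h : StandingAssumptions U V A f g) {y : Aug n m}
    (hy : y ∈ (univ : Set (Vec n)) ×ˢ V) : (expField (negCombination g y.2) y).2 = 0 := by
  obtain ⟨c, hc⟩ := h.exp_defined y hy
  rw [h.expField_eq hy hc, (h.mapsTo_domain hy hc).1 1 (right_mem_Icc.2 zero_le_one)]
  simp

/-- Smoothness of the exponential, and its derivative in terms of the linearized equation. -/
theorem contDiffAt_expField (h : StandingAssumptions U V A f g) {y : Aug n m}
    (hy : y ∈ (univ : Set (Vec n)) ×ˢ V) {c : ℝ → Aug n m}
    (hc : IsUnitIntegralCurve (negCombination g y.2) y c) :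
    ContDiffAt ℝ 2 (fun y' => expField (negCombination g y'.2) y') y ∧
    ∀ w : Aug n m, ∃ r : ℝ → Aug n m × Vec m, r 0 = (w, w.2) ∧
      (r 1).1 = fderiv ℝ (fun y' => expField (negCombination g y'.2) y') y w ∧
      ∀ t ∈ Icc (0 : ℝ) 1,
        HasDerivWithinAt r (fderiv ℝ (extendedField g) (c t, y.2) (r t)) (Icc 0 1) t := by
  have hcD := (h.mapsTo_domain hy hc).2
  have hΩ : IsOpen (((univ : Set (Vec n)) ×ˢ V) ×ˢ (univ : Set (Vec m))) :=
    h.isOpen_domain.prod isOpen_univ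
  -- The point `(x, z)` is both the starting point and the source of the coefficients of the field.
  -- In the extended system both roles are initial data, so dependence on a parameter becomes
  -- dependence on the initial point `(y, y.2)`.
  obtain ⟨F, hF, hFe, hF'⟩ := exists_contDiffAt_flow (n := 2) two_ne_zero hΩ
    (by exact_mod_cast h.contDiffOn_extendedField) (c := fun t => (c t, y.2))
    (fun t ht => (hc.2 t ht).prodMk (hasDerivWithinAt_const t _ y.2))
    (fun t ht => ⟨hcD ht, trivial⟩)
  rw [hc.1] at hF hFe hF'
  let ι : Aug n m →L[ℝ] Aug n m × Vec m :=
    (ContinuousLinearMap.id ℝ (Aug n m)).prod (ContinuousLinearMap.snd ℝ (Vec n) (Vec m))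
  let ε : C(unitInterval, Aug n m × Vec m) →L[ℝ] Aug n m :=
    (ContinuousLinearMap.fst ℝ (Aug n m) (Vec m)).comp (ContinuousMap.evalCLM ℝ (1 : unitInterval))
  have hev : (fun y' => expField (negCombination g y'.2) y') =ᶠ[𝓝 y] fun y' => ε (F (ι y')) := by
    have h1 : Tendsto ι (𝓝 y) (𝓝 (y, y.2)) := ι.continuous.continuousAt
    filter_upwards [h1.eventually hFe, h.isOpen_domain.mem_nhds hy] with y' ⟨⟨h2, h3⟩, h4⟩ hy'
    have h5 : ∀ t ∈ Icc (0 : ℝ) 1,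
        (IccExtend (zero_le_one' ℝ) (F (ι y')) t).2 = y'.2 := by
      intro t ht
      have := eq_left_of_hasDerivWithinAt_const (e := 0) (fun t ht =>
        (hasFDerivAt_snd (p := IccExtend (zero_le_one' ℝ) (F (ι y')) t)).comp_hasDerivWithinAt t
          (h3 t ht)) t ht
      rw [Function.comp_apply, Function.comp_apply, h2, smul_zero, add_zero] at this
      exact this
    have h6 : IsUnitIntegralCurve (negCombination g y'.2) y'
        (fun t => (IccExtend (zero_le_one' ℝ) (F (ι y')) t).1) := by
      refine ⟨congrArg Prod.fst h2, fun t ht => ?_⟩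
      have := (hasFDerivAt_fst (p := IccExtend (zero_le_one' ℝ) (F (ι y')) t)).comp_hasDerivWithinAt
        t (h3 t ht)
      simpa [extendedField, h5 t ht] using! this
    rw [h.expField_eq hy' h6, IccExtend_of_mem _ _ (right_mem_Icc.2 zero_le_one)]
    rfl
  have hFι : ContDiffAt ℝ 2 (fun y' => ε (F (ι y'))) y :=
    ε.contDiff.contDiffAt.comp y (ContDiffAt.comp (g := F) y hF ι.contDiff.contDiffAt)
  refine ⟨hFι.congr_of_eventuallyEq hev, fun w => ?_⟩
  obtain ⟨r, hr0, hr1, hr⟩ := hF' (ι w)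
  refine ⟨r, hr0, ?_, hr⟩
  have h1 : HasFDerivAt (fun y' => ε (F (ι y'))) (ε.comp ((fderiv ℝ F (y, y.2)).comp ι)) y :=
    ε.hasFDerivAt.comp y (HasFDerivAt.comp (g := F) y
      (hF.differentiableAt two_ne_zero).hasFDerivAt ι.hasFDerivAt)
  rw [hev.fderiv_eq, h1.fderiv, hr1]
  rfl

theorem norm_fderiv_extendedField_le (h : StandingAssumptions U V A f g) {y : Aug n m}
    (hy : y ∈ (univ : Set (Vec n)) ×ˢ V) {c : ℝ → Aug n m}
    (hc : IsUnitIntegralCurve (negCombination g y.2) y c) :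
    ∃ C, ∀ t ∈ Icc (0 : ℝ) 1, ‖fderiv ℝ (extendedField g) (c t, y.2)‖ ≤ C := by
  refine isCompact_Icc.exists_bound_of_continuousOn (ContinuousOn.comp
    (h.contDiffOn_extendedField.continuousOn_fderiv_of_isOpen
      (h.isOpen_domain.prod isOpen_univ) one_le_two)
    (hc.2.continuousOn.prodMk continuousOn_const)
    fun t ht => ⟨(h.mapsTo_domain hy hc).2 ht, trivial⟩)

theorem fderiv_gField_comm (h : StandingAssumptions U V A f g) {y : Aug n m}
    (hy : y ∈ (univ : Set (Vec n)) ×ˢ V) (α β : Fin m) :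
    fderiv ℝ (gField g α) y (gField g β y) = fderiv ℝ (gField g β) y (gField g α y) := by
  have := h.g_comm β α y hy
  rwa [VectorField.lieBracket, sub_eq_zero] at this

theorem hasFDerivAt_expField (h : StandingAssumptions U V A f g) {y : Aug n m}
    (hy : y ∈ (univ : Set (Vec n)) ×ˢ V) :
    HasFDerivAt (fun y' => expField (negCombination g y'.2) y')
      (fderiv ℝ (fun y' => expField (negCombination g y'.2) y') y) y := by
  obtain ⟨c, hc⟩ := h.exp_defined y hy
  exact ((h.contDiffAt_expField hy hc).1.differentiableAt two_ne_zero).hasFDerivAt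

/-- The linearized equation with initial variation `∑ v^k g_k` has the explicit solution `(1 - t) ∑
v^k g_k(c t)`, which vanishes at `t = 1`. Differentiating the factor `1 - t` accounts for the
variation of the coefficients `z`; the remaining terms match because the fields commute. -/
theorem fderiv_expField_controlField (h : StandingAssumptions U V A f g) {y : Aug n m}
    (hy : y ∈ (univ : Set (Vec n)) ×ˢ V) (v : Vec m) :
    fderiv ℝ (fun y' => expField (negCombination g y'.2) y') y (controlField g v y) = 0 := by
  obtain ⟨c, hc⟩ := h.exp_defined y hy
  obtain ⟨r, hr0, hr1, hr⟩ := (h.contDiffAt_expField hy hc).2 (controlField g v y)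
  obtain ⟨C, hC⟩ := h.norm_fderiv_extendedField_le hy hc
  have h1 : ∀ t ∈ Icc (0 : ℝ) 1, HasDerivWithinAt (fun t => ((1 - t) • controlField g v (c t), v))
      (fderiv ℝ (extendedField g) (c t, y.2) ((1 - t) • controlField g v (c t), v)) (Icc 0 1) t := by
    intro t ht
    have hct := (h.mapsTo_domain hy hc).2 ht
    have h2 : HasDerivWithinAt (fun t => controlField g v (c t))
        (∑ k, v k • fderiv ℝ (gField g k) (c t) (negCombination g y.2 (c t))) (Icc 0 1) t :=
      HasDerivWithinAt.fun_sum fun k _ =>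
        ((h.hasFDerivAt_gField k hct).comp_hasDerivWithinAt t (hc.2 t ht)).const_smul (v k)
    have h3 := ((((hasDerivAt_id t).const_sub 1).hasDerivWithinAt (s := Icc 0 1)).smul h2).prodMk
      (hasDerivWithinAt_const t (Icc 0 1) v)
    refine h3.congr_deriv ?_
    rw [h.fderiv_extendedField hct]
    congr 1
    -- The only use of commutativity: `∇g_k · g_j = ∇g_j · g_k` exchanges the coefficients `v` and
    -- `z`.
    have h4 : ∑ k, v k • fderiv ℝ (gField g k) (c t) (negCombination g y.2 (c t)) =
        -∑ k, y.2 k • fderiv ℝ (gField g k) (c t) (controlField g v (c t)) := by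
      simp only [negCombination, controlField, map_neg, map_sum, map_smul, smul_neg,
        Finset.sum_neg_distrib, Finset.smul_sum]
      rw [Finset.sum_comm]
      refine congrArg _ (Finset.sum_congr rfl fun i _ => Finset.sum_congr rfl fun j _ => ?_)
      rw [h.fderiv_gField_comm hct, smul_comm]
    rw [h4]
    simp only [map_smul, Finset.sum_add_distrib, id, neg_add, smul_neg, neg_smul, one_smul,
      Finset.smul_sum]
    rw [show ∑ k, v k • gField g k (c t) = controlField g v (c t) from rfl]
    congr 2
    exact Finset.sum_congr rfl fun i _ => smul_comm _ _ _
  have h2 := eqOn_of_hasDerivWithinAt_linear hC hr h1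
    (Or.inl (by rw [hr0, hc.1, controlField_snd]; simp)) (right_mem_Icc.2 zero_le_one)
  rw [← hr1, h2]
  simp

theorem contDiffAt_phi (h : StandingAssumptions U V A f g) {y : Aug n m}
    (hy : y ∈ (univ : Set (Vec n)) ×ˢ V) : ContDiffAt ℝ 2 (phi g) y := by
  obtain ⟨c, hc⟩ := h.exp_defined y hy
  exact (contDiff_fst.contDiffAt.comp y (h.contDiffAt_expField hy hc).1).prodMk contDiffAt_snd

theorem fderiv_phi_apply (h : StandingAssumptions U V A f g) {y : Aug n m}
    (hy : y ∈ (univ : Set (Vec n)) ×ˢ V) (w : Aug n m) : fderiv ℝ (phi g) y w =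
      ((fderiv ℝ (fun y' => expField (negCombination g y'.2) y') y w).1, w.2) := by
  have h1 : HasFDerivAt (phi g) _ y :=
    (hasFDerivAt_fst.comp y (h.hasFDerivAt_expField hy)).prodMk (hasFDerivAt_snd (p := y))
  rw [h1.fderiv]
  rfl

/-- The straightening property: the impulsive fields become constant coordinate fields, which is why
`ẇ` drops out of the transformed first component. -/
theorem fderiv_phi_gField (h : StandingAssumptions U V A f g) {y : Aug n m}
    (hy : y ∈ (univ : Set (Vec n)) ×ˢ V) (α : Fin m) :
    fderiv ℝ (phi g) y (gField g α y) = (0, EuclideanSpace.single α 1) := by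
  have h1 : gField g α y = controlField g (EuclideanSpace.single α 1) y := by
    simp [controlField]
  rw [h1, h.fderiv_phi_apply hy, h.fderiv_expField_controlField hy, controlField_snd]
  rfl

/-- For a vector in the kernel, the solution of the linearized extended equation vanishes at time
`1`: its remaining component is constant, equal to `w.2 = 0`. Backward uniqueness makes it vanish at
time `0`. -/
theorem fderiv_phi_injective (h : StandingAssumptions U V A f g) {y : Aug n m}
    (hy : y ∈ (univ : Set (Vec n)) ×ˢ V) : Function.Injective (fderiv ℝ (phi g) y) := by
  rw [injective_iff_map_eq_zero]
  intro w hw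
  rw [h.fderiv_phi_apply hy, Prod.mk_eq_zero] at hw
  obtain ⟨c, hc⟩ := h.exp_defined y hy
  obtain ⟨r, hr0, hr1, hr⟩ := (h.contDiffAt_expField hy hc).2 w
  obtain ⟨C, hC⟩ := h.norm_fderiv_extendedField_le hy hc
  have h1 : (fderiv ℝ (fun y' => expField (negCombination g y'.2) y') y w).2 = 0 := by
    have h2 : HasFDerivAt (fun y' => (expField (negCombination g y'.2) y').2) _ y :=
      hasFDerivAt_snd.comp y (h.hasFDerivAt_expField hy)
    have h3 : (fun y' => (expField (negCombination g y'.2) y').2) =ᶠ[𝓝 y] fun _ => 0 := by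
      filter_upwards [h.isOpen_domain.mem_nhds hy] with y' hy' using h.expField_snd hy'
    exact DFunLike.congr_fun (h2.unique ((hasFDerivAt_const (0 : Vec m) y).congr_of_eventuallyEq h3)) w
  have h2 : (r 1).2 = 0 := by
    have := eq_left_of_hasDerivWithinAt_const (h := fun t => (r t).2) (e := 0) (fun t ht => by
      have h3 := (hasFDerivAt_snd (p := r t)).comp_hasDerivWithinAt t (hr t ht)
      rwa [show r t = ((r t).1, (r t).2) from rfl,
        h.fderiv_extendedField ((h.mapsTo_domain hy hc).2 ht)] at h3) 1 (right_mem_Icc.2 zero_le_one)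
    simpa [hr0, hw.2] using! this
  have h3 := eqOn_of_hasDerivWithinAt_linear hC hr (h' := fun _ => 0)
    (fun t _ => by rw [map_zero]; exact hasDerivWithinAt_const t _ 0)
    (Or.inr (Prod.ext (by rw [hr1]; exact Prod.ext hw.1 h1) h2)) (left_mem_Icc.2 zero_le_one)
  rw [hr0] at h3
  exact congrArg Prod.fst h3

/-- Points with equal images share `z`, hence the field. Nothing is lost by keeping only the
`x`-component of the exponential, since its other component is `0`; so the two curves end at one
point and coincide by backward uniqueness. -/
theorem injOn_phi (h : StandingAssumptions U V A f g) : InjOn (phi g) (univ ×ˢ V) := by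
  intro y hy y' hy' he
  obtain ⟨c, hc⟩ := h.exp_defined y hy
  obtain ⟨c', hc'⟩ := h.exp_defined y' hy'
  have hz : y'.2 = y.2 := (congrArg Prod.snd he).symm
  have h1 : expField (negCombination g y.2) y = expField (negCombination g y'.2) y' :=
    Prod.ext (congrArg Prod.fst he :) ((h.expField_snd hy).trans (h.expField_snd hy').symm)
  rw [h.expField_eq hy hc, h.expField_eq hy' hc'] at h1
  have hm' := (h.mapsTo_domain hy' hc').2
  rw [hz] at hc'
  have := eqOn_of_isIntegralCurveOn h.isOpen_domain
    ((h.contDiffOn_negCombination y.2).of_le one_le_two) hc.2 hc'.2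
    (h.mapsTo_domain hy hc).2 hm' (Or.inr h1) (left_mem_Icc.2 zero_le_one)
  rwa [hc.1, hc'.1] at this

theorem phiInv_phi (h : StandingAssumptions U V A f g) {y : Aug n m}
    (hy : y ∈ (univ : Set (Vec n)) ×ˢ V) : phiInv g V (phi g y) = y :=
  h.injOn_phi.leftInvOn_invFunOn hy

/-- The derivative of the change of coordinates, as an equivalence. -/
def fderivPhiEquiv (h : StandingAssumptions U V A f g) {y : Aug n m}
    (hy : y ∈ (univ : Set (Vec n)) ×ˢ V) : Aug n m ≃L[ℝ] Aug n m :=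
  (LinearEquiv.ofInjectiveEndo (fderiv ℝ (phi g) y : Aug n m →ₗ[ℝ] Aug n m)
    (h.fderiv_phi_injective hy)).toContinuousLinearEquiv

/-- The set-theoretic inverse `phiInv` agrees near `φ(y)` with the inverse furnished by the inverse
function theorem, because `φ` is injective on the whole domain. -/
theorem contDiffAt_phiInv (h : StandingAssumptions U V A f g) {y : Aug n m}
    (hy : y ∈ (univ : Set (Vec n)) ×ˢ V) : ContDiffAt ℝ 2 (phiInv g V) (phi g y) ∧
      ∀ᶠ q in 𝓝 (phi g y), phiInv g V q ∈ (univ : Set (Vec n)) ×ˢ V ∧ phi g (phiInv g V q) = q := by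
  have h1 := h.contDiffAt_phi hy
  have hD : HasFDerivAt (phi g) (h.fderivPhiEquiv hy : Aug n m →L[ℝ] Aug n m) y :=
    (h1.differentiableAt two_ne_zero).hasFDerivAt
  have h2 := h1.to_localInverse hD two_ne_zero
  have h3 := (h1.hasStrictFDerivAt' hD two_ne_zero).eventually_right_inverse
  have h4 : ∀ᶠ q in 𝓝 (phi g y), h1.localInverse hD two_ne_zero q ∈ (univ : Set (Vec n)) ×ˢ V := by
    refine h2.continuousAt.eventually_mem (h.isOpen_domain.mem_nhds ?_)
    rwa [h1.localInverse_apply_image hD two_ne_zero]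
  have h5 : ∀ᶠ q in 𝓝 (phi g y), phiInv g V q = h1.localInverse hD two_ne_zero q := by
    filter_upwards [h3, h4] with q hq hq'
    conv_lhs => rw [← hq]
    exact h.phiInv_phi hq'
  refine ⟨h2.congr_of_eventuallyEq h5, ?_⟩
  filter_upwards [h3, h4, h5] with q hq hq' hq''
  rw [hq'']
  exact ⟨hq', hq⟩

end StandingAssumptions

end ChangeOfCoordinates

/-! ### Chain rule for absolutely continuous curves -/

theorem AbsolutelyContinuousOnInterval.of_dist_le {X Y : Type*} [PseudoMetricSpace X]
    [PseudoMetricSpace Y] {f : ℝ → X} {h : ℝ → Y} {a b L : ℝ}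
    (hf : AbsolutelyContinuousOnInterval f a b)
    (hL : ∀ s ∈ uIcc a b, ∀ t ∈ uIcc a b, dist (h s) (h t) ≤ L * dist (f s) (f t)) :
    AbsolutelyContinuousOnInterval h a b := by
  have h1 : Tendsto (fun _ : ℕ × (ℕ → ℝ × ℝ) => (0 : ℝ))
      (AbsolutelyContinuousOnInterval.totalLengthFilter ⊓
        𝓟 (AbsolutelyContinuousOnInterval.disjWithin a b)) (𝓝 0) := tendsto_const_nhds
  have h2 := Tendsto.const_mul L hf
  rw [mul_zero] at h2
  refine tendsto_of_tendsto_of_tendsto_of_le_of_le' h1 h2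
    (Eventually.of_forall fun E => Finset.sum_nonneg fun i _ => dist_nonneg) ?_
  filter_upwards [mem_inf_of_right (mem_principal_self _)] with E hE
  rw [Finset.mul_sum]
  refine Finset.sum_le_sum fun i hi => ?_
  have := hE.1 i hi
  exact hL _ this.1 _ this.2

theorem absolutelyContinuousOnInterval_primitive {E : Type*} [NormedAddCommGroup E]
    [NormedSpace ℝ E] {R : ℝ → E} {T : ℝ} (hR : IntervalIntegrable R volume 0 T) :
    AbsolutelyContinuousOnInterval (fun t => ∫ s in (0 : ℝ)..t, R s) 0 T := by
  have h1 := hR.norm.absolutelyContinuousOnInterval_intervalIntegral (c := 0) left_mem_uIcc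
  refine h1.of_dist_le (L := 1) fun s hs t ht => ?_
  have hi : ∀ r ∈ uIcc 0 T, IntervalIntegrable R volume 0 r := fun r hr =>
    hR.mono_set (uIcc_subset_uIcc_left hr)
  rw [one_mul, dist_eq_norm, dist_eq_norm, intervalIntegral.integral_interval_sub_left (hi s hs) (hi t ht),
    intervalIntegral.integral_interval_sub_left (hi s hs).norm (hi t ht).norm]
  exact intervalIntegral.norm_integral_le_abs_integral_norm

/-- Chain rule for a `C¹` map along an absolutely continuous curve. -/
theorem comp_eq_add_integral {E F : Type*} [NormedAddCommGroup E] [NormedSpace ℝ E]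
    [FiniteDimensional ℝ E] [NormedAddCommGroup F] [NormedSpace ℝ F] [CompleteSpace F]
    {Ω : Set E} (hΩ : IsOpen Ω) {Φ : E → F} (hΦ : ContDiffOn ℝ 1 Φ Ω) {T : ℝ} (hT : 0 ≤ T)
    {y R : ℝ → E} (hR : IntervalIntegrable R volume 0 T)
    (hy : ∀ t ∈ Icc 0 T, y t = y 0 + ∫ s in (0 : ℝ)..t, R s) (hyΩ : MapsTo y (Icc 0 T) Ω) :
    IntervalIntegrable (fun s => fderiv ℝ Φ (y s) (R s)) volume 0 T ∧
      ∀ t ∈ Icc 0 T, Φ (y t) = Φ (y 0) + ∫ s in (0 : ℝ)..t, fderiv ℝ Φ (y s) (R s) := by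
  have : CompleteSpace E := FiniteDimensional.complete ℝ E
  have hacy : AbsolutelyContinuousOnInterval y 0 T :=
    (absolutelyContinuousOnInterval_primitive hR).of_dist_le (L := 1) fun s hs t ht => by
      rw [uIcc_of_le hT] at hs ht
      rw [hy s hs, hy t ht, dist_add_left, one_mul]
  have hyc : ContinuousOn y (Icc 0 T) := by
    have := hacy.continuousOn
    rwa [uIcc_of_le hT] at this
  have hdc : ContinuousOn (fun s => fderiv ℝ Φ (y s)) (Icc 0 T) :=
    (hΦ.continuousOn_fderiv_of_isOpen hΩ le_rfl).comp hyc hyΩ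
  have hint : IntervalIntegrable (fun s => fderiv ℝ Φ (y s) (R s)) volume 0 T := by
    obtain ⟨C, hC⟩ := isCompact_Icc.exists_bound_of_continuousOn hdc
    rw [intervalIntegrable_iff_integrableOn_Icc_of_le hT] at hR ⊢
    refine Integrable.mono' (hR.norm.const_mul C) ?_ ?_
    · exact (ContinuousLinearMap.apply ℝ F).flip.aestronglyMeasurable_comp₂
        (hdc.aestronglyMeasurable measurableSet_Icc) hR.1
    · filter_upwards [ae_restrict_mem measurableSet_Icc] with s hs
      exact ((fderiv ℝ Φ (y s)).le_opNorm _).trans (by gcongr; exact hC s hs)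
  refine ⟨hint, ?_⟩
  obtain ⟨Y, hY, hYc, hYΦ⟩ := exists_contDiff_eqOn_nhdsSet (n := 1) hΩ
    (isCompact_Icc.image_of_continuousOn hyc) hyΩ.image_subset (by exact_mod_cast hΦ)
  have hYΦ' := hYΦ.self_of_nhdsSet
  obtain ⟨L, hL⟩ := hY.lipschitzWith_of_hasCompactSupport hYc (by simp)
  -- Both terms are absolutely continuous, the first because `Y` is globally Lipschitz. Their
  -- difference has derivative zero almost everywhere, hence is constant.
  have hac : AbsolutelyContinuousOnInterval
      ((fun t => Y (y t)) - fun t => ∫ s in (0 : ℝ)..t, fderiv ℝ Φ (y s) (R s)) 0 T :=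
    (hacy.of_dist_le (L := L) fun s _ t _ => hL.dist_le_mul _ _).sub
      (absolutelyContinuousOnInterval_primitive hint)
  obtain ⟨e, he⟩ := hac.const_of_ae_hasDerivAt_zero (by
    have h0 : ∀ᵐ x : ℝ, x ≠ 0 := by simp [ae_iff, measure_singleton]
    have hT' : ∀ᵐ x : ℝ, x ≠ T := by simp [ae_iff, measure_singleton]
    filter_upwards [hR.ae_hasDerivAt_integral, hint.ae_hasDerivAt_integral, h0, hT'] with
      x h1 h2 hx0 hxT hx
    have h1 := h1 hx 0 left_mem_uIcc
    have h2 := h2 hx 0 left_mem_uIcc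
    rw [uIcc_of_le hT] at hx
    have hxo : Icc 0 T ∈ 𝓝 x := Icc_mem_nhds (lt_of_le_of_ne hx.1 hx0.symm) (lt_of_le_of_ne hx.2 hxT)
    have h3 : HasDerivAt y (R x) x := (h1.const_add (y 0)).congr_of_eventuallyEq
      (mem_of_superset hxo fun t ht => hy t ht)
    have h4 : HasFDerivAt Y (fderiv ℝ Φ (y x)) (y x) := by
      have h5 := (hY.differentiable (by simp) (y x)).hasFDerivAt
      rwa [Filter.EventuallyEq.fderiv_eq (hYΦ.filter_mono (nhds_le_nhdsSet
        (mem_image_of_mem y hx)))] at h5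
    have := (h4.comp_hasDerivAt x h3).sub h2
    rwa [sub_self] at this)
  rw [uIcc_of_le hT] at he
  intro t ht
  have h0 : (0 : ℝ) ∈ Icc 0 T := ⟨le_rfl, hT⟩
  have h1 := (he t ht).trans (he 0 h0).symm
  simp only [Pi.sub_apply, intervalIntegral.integral_same, sub_zero] at h1
  rw [hYΦ' _ (mem_image_of_mem y ht), hYΦ' _ (mem_image_of_mem y h0)] at h1
  exact sub_eq_iff_eq_add.1 h1

/-! ### Measurability of derivatives along measurable curves -/

theorem aestronglyMeasurable_clm_of_apply {α E F : Type*} [MeasurableSpace α] {μ : Measure α}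
    [NormedAddCommGroup E] [NormedSpace ℝ E] [FiniteDimensional ℝ E]
    [NormedAddCommGroup F] [NormedSpace ℝ F] {f : α → E →L[ℝ] F}
    (hf : ∀ v, AEStronglyMeasurable (fun s => f s v) μ) : AEStronglyMeasurable f μ := by
  let b := Module.finBasis ℝ E
  have h1 : f = fun s => ∑ i, (LinearMap.toContinuousLinearMap (b.coord i)).smulRight (f s (b i)) := by
    funext s
    ext v
    conv_lhs => rw [← b.sum_repr v, map_sum]
    simp
  rw [h1]
  refine Finset.aestronglyMeasurable_fun_sum _ fun i _ => ?_
  exact (ContinuousLinearMap.smulRightL ℝ E F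
    (LinearMap.toContinuousLinearMap (b.coord i))).continuous.comp_aestronglyMeasurable (hf (b i))

theorem ContinuousOn.comp_aestronglyMeasurable_of_mem {α E F : Type*} [MeasurableSpace α]
    {μ : Measure α} [NormedAddCommGroup E] [NormedAddCommGroup F] [NormedSpace ℝ F]
    [FiniteDimensional ℝ F] {O : Set E} {Φ : E → F} (hΦ : ContinuousOn Φ O) (hO : IsOpen O)
    {y : α → E} (hy : AEStronglyMeasurable y μ) (hyO : ∀ᵐ s ∂μ, y s ∈ O) :
    AEStronglyMeasurable (fun s => Φ (y s)) μ := by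
  classical
  borelize E F
  have := FiniteDimensional.proper ℝ F
  have h1 : Measurable (O.piecewise Φ fun _ => 0) :=
    hΦ.measurable_piecewise continuousOn_const hO.measurableSet
  refine (h1.comp_aemeasurable hy.aemeasurable).aestronglyMeasurable.congr ?_
  filter_upwards [hyO] with s hs
  exact piecewise_eq_of_mem _ _ _ hs

/-- The derivative need not be continuous in the parameter `p`; it is a pointwise limit of
difference quotients of the jointly continuous `H`, and that suffices for measurability. -/
theorem aestronglyMeasurable_fderiv_param {α E P F : Type*} [MeasurableSpace α] {μ : Measure α}
    [NormedAddCommGroup E] [NormedSpace ℝ E] [FiniteDimensional ℝ E] [MeasurableSpace E]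
    [BorelSpace E] [TopologicalSpace P] [SecondCountableTopology P] [MeasurableSpace P] [BorelSpace P]
    [NormedAddCommGroup F] [NormedSpace ℝ F] [SecondCountableTopology F]
    {O : Set E} (hO : IsOpen O) {A : Set P} (hA : MeasurableSet A) {H : E → P → F}
    (hH : ContinuousOn (Function.uncurry H) (O ×ˢ A))
    (hd : ∀ p ∈ A, ∀ y ∈ O, DifferentiableAt ℝ (fun y => H y p) y) {y : α → E} {a : α → P}
    (hy : AEMeasurable y μ) (ha : AEMeasurable a μ) (hya : ∀ᵐ s ∂μ, y s ∈ O ∧ a s ∈ A) :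
    AEStronglyMeasurable (fun s => fderiv ℝ (fun y => H y (a s)) (y s)) μ := by
  classical
  borelize F
  have := FiniteDimensional.proper ℝ E
  -- Extension by zero, since `y s + (k + 1)⁻¹ • v` may leave `O` for small `k`.
  set Ĥ : E × P → F := (O ×ˢ A).piecewise (Function.uncurry H) (fun _ => 0) with hĤ
  have hm : Measurable Ĥ := hH.measurable_piecewise continuousOn_const (hO.measurableSet.prod hA)
  refine aestronglyMeasurable_clm_of_apply fun v => ?_
  refine aestronglyMeasurable_of_tendsto_ae (atTop : Filter ℕ) (f := fun k s => ((k : ℝ) + 1) •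
    (Ĥ (y s + ((k : ℝ) + 1)⁻¹ • v, a s) - Ĥ (y s, a s))) (fun k => ?_) ?_
  · have h1 := hm.comp_aemeasurable ((hy.add_const (((k : ℝ) + 1)⁻¹ • v)).prodMk ha)
    have h2 := hm.comp_aemeasurable (hy.prodMk ha)
    exact ((h1.sub h2).const_smul ((k : ℝ) + 1)).aestronglyMeasurable
  · filter_upwards [hya] with s hs
    have hc : Tendsto (fun k : ℕ => ‖(k : ℝ) + 1‖) atTop atTop :=
      tendsto_norm_atTop_atTop.comp (tendsto_atTop_add_const_right _ 1 tendsto_natCast_atTop_atTop)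
    have h1 := (hd _ hs.2 _ hs.1).hasFDerivAt.lim v hc
    refine h1.congr' ?_
    have h2 : Tendsto (fun k : ℕ => y s + ((k : ℝ) + 1)⁻¹ • v) atTop (𝓝 (y s)) := by
      have h3 : Tendsto (fun k : ℕ => ((k : ℝ) + 1)⁻¹) atTop (𝓝 0) :=
        tendsto_inv_atTop_zero.comp (tendsto_atTop_add_const_right _ 1 tendsto_natCast_atTop_atTop)
      simpa using tendsto_const_nhds.add (h3.smul_const v)
    filter_upwards [h2.eventually_mem (hO.mem_nhds hs.1)] with k hk
    rw [hĤ, piecewise_eq_of_mem _ _ _ (show (y s + ((k : ℝ) + 1)⁻¹ • v, a s) ∈ O ×ˢ A from ⟨hk, hs.2⟩),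
      piecewise_eq_of_mem _ _ _ (show (y s, a s) ∈ O ×ˢ A from hs)]
    rfl

/-- Superposition with a bounded Carathéodory function preserves convergence in `L¹`. -/
theorem tendsto_lintegral_enorm_comp_sub {α E G : Type*} [MeasurableSpace α] {μ : Measure α}
    [IsFiniteMeasure μ] [NormedAddCommGroup E] [NormedAddCommGroup G]
    {y : ℕ → α → E} {z : α → E} (hy : ∀ k, AEStronglyMeasurable (y k) μ)
    (hz : AEStronglyMeasurable z μ) (hyz : Tendsto (fun k => ∫⁻ t, ‖y k t - z t‖ₑ ∂μ) atTop (𝓝 0))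
    {S : Set E} (hyS : ∀ᵐ t ∂μ, ∀ k, y k t ∈ S) (hzS : ∀ᵐ t ∂μ, z t ∈ S) {H : α → E → G} {C : ℝ}
    (hH : ∀ᵐ t ∂μ, ContinuousOn (H t) S) (hC : ∀ᵐ t ∂μ, ∀ q ∈ S, ‖H t q‖ ≤ C)
    (hHy : ∀ k, AEStronglyMeasurable (fun t => H t (y k t)) μ)
    (hHz : AEStronglyMeasurable (fun t => H t (z t)) μ) :
    Tendsto (fun k => ∫⁻ t, ‖H t (y k t) - H t (z t)‖ₑ ∂μ) atTop (𝓝 0) := by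
  have hmeas : TendstoInMeasure μ y atTop z :=
    tendstoInMeasure_of_tendsto_eLpNorm one_ne_zero hy hz (by simpa [eLpNorm_one_eq_lintegral_enorm])
  -- Every subsequence has a further subsequence converging almost everywhere, to which dominated
  -- convergence with the constant `2C` applies.
  refine tendsto_of_subseq_tendsto fun ns hns => ?_
  obtain ⟨ms, -, hms⟩ := (hmeas.comp hns).exists_seq_tendsto_ae
  refine ⟨ms, ?_⟩
  have := tendsto_lintegral_of_dominated_convergence' (μ := μ)
    (F := fun j t => ‖H t (y (ns (ms j)) t) - H t (z t)‖ₑ) (f := fun _ => 0)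
    (fun _ => ENNReal.ofReal (C + C)) (fun j => ((hHy _).sub hHz).enorm) ?_ ?_ ?_
  · simpa using this
  · intro j
    filter_upwards [hyS, hzS, hC] with t h1 h2 h3
    rw [← ofReal_norm]
    exact ENNReal.ofReal_le_ofReal ((norm_sub_le _ _).trans (add_le_add (h3 _ (h1 _)) (h3 _ h2)))
  · rw [lintegral_const]
    exact ENNReal.mul_ne_top ENNReal.ofReal_ne_top (measure_ne_top _ _)
  · filter_upwards [hyS, hzS, hH, hms] with t h1 h2 h3 h4
    have h5 : Tendsto (fun j => H t (y (ns (ms j)) t)) atTop (𝓝 (H t (z t))) :=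
      (h3 (z t) h2).tendsto.comp (tendsto_nhdsWithin_iff.2 ⟨h4, Eventually.of_forall fun j => h1 _⟩)
    have h6 := (h5.sub_const (H t (z t))).enorm
    simpa using h6

/-! ### The transformed drift -/

section TransformedDrift

variable {n m l : ℕ} {U V : Set (Vec m)} {A : Set (Vec l)} {f : Aug n m → Vec l → Vec n}
  {g : Fin m → Aug n m → Vec n}

/-- The Jacobian of the transformed drift `(F̃(·, a), 0)` at the point `φ(y)`. -/
def transformedJacobian (f : Aug n m → Vec l → Vec n) (g : Fin m → Aug n m → Vec n)
    (V : Set (Vec m)) (a : Vec l) (y : Aug n m) : Aug n m →L[ℝ] Aug n m :=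
  (fderiv ℝ (fun q => Ftilde f g V q a) (phi g y)).prod 0

/-- The derivative at `y` of `y' ↦ ∇φ(y') f(y', a)`. -/
def driftVariation (f : Aug n m → Vec l → Vec n) (g : Fin m → Aug n m → Vec n)
    (a : Vec l) (y : Aug n m) : Aug n m →L[ℝ] Aug n m :=
  (fderiv ℝ (phi g) y).comp (fderiv ℝ (driftField f a) y) +
    (fderiv ℝ (fderiv ℝ (phi g)) y).flip (driftField f a y)

namespace StandingAssumptions

theorem phi_contDiffOn (h : StandingAssumptions U V A f g) :
    ContDiffOn ℝ 2 (phi g) (univ ×ˢ V) := fun _ hy => (h.contDiffAt_phi hy).contDiffWithinAt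

theorem contDiffOn_fderiv_phi (h : StandingAssumptions U V A f g) :
    ContDiffOn ℝ 1 (fderiv ℝ (phi g)) (univ ×ˢ V) :=
  h.phi_contDiffOn.fderiv_of_isOpen h.isOpen_domain (by norm_num)

theorem hasFDerivAt_fderiv_phi (h : StandingAssumptions U V A f g) {y : Aug n m}
    (hy : y ∈ (univ : Set (Vec n)) ×ˢ V) :
    HasFDerivAt (fderiv ℝ (phi g)) (fderiv ℝ (fderiv ℝ (phi g)) y) y :=
  ((h.contDiffOn_fderiv_phi.contDiffAt (h.isOpen_domain.mem_nhds hy)).differentiableAt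
    one_ne_zero).hasFDerivAt

theorem contDiffOn_driftField (h : StandingAssumptions U V A f g) {a : Vec l} (ha : a ∈ A) :
    ContDiffOn ℝ 1 (driftField f a) ((univ : Set (Vec n)) ×ˢ V) :=
  (h.f_contDiff a ha).prodMk contDiffOn_const

theorem hasFDerivAt_driftField (h : StandingAssumptions U V A f g) {a : Vec l} (ha : a ∈ A)
    {y : Aug n m} (hy : y ∈ (univ : Set (Vec n)) ×ˢ V) :
    HasFDerivAt (driftField f a) (fderiv ℝ (driftField f a) y) y :=
  (((h.contDiffOn_driftField ha).contDiffAt (h.isOpen_domain.mem_nhds hy)).differentiableAt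
    one_ne_zero).hasFDerivAt

theorem hasFDerivAt_driftVariation (h : StandingAssumptions U V A f g) {a : Vec l} (ha : a ∈ A)
    {y : Aug n m} (hy : y ∈ (univ : Set (Vec n)) ×ˢ V) :
    HasFDerivAt (fun y' => fderiv ℝ (phi g) y' (driftField f a y')) (driftVariation f g a y) y :=
  (h.hasFDerivAt_fderiv_phi hy).clm_apply (h.hasFDerivAt_driftField ha hy)

theorem driftVariation_snd (h : StandingAssumptions U V A f g) {a : Vec l} (ha : a ∈ A)
    {y : Aug n m} (hy : y ∈ (univ : Set (Vec n)) ×ˢ V) (w : Aug n m) :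
    (driftVariation f g a y w).2 = 0 := by
  have h1 := hasFDerivAt_snd.comp y (h.hasFDerivAt_driftVariation ha hy)
  have h2 : (Prod.snd ∘ fun y' => fderiv ℝ (phi g) y' (driftField f a y')) =ᶠ[𝓝 y] fun _ => 0 := by
    filter_upwards [h.isOpen_domain.mem_nhds hy] with y' hy'
    rw [Function.comp_apply, h.fderiv_phi_apply hy']
    rfl
  exact DFunLike.congr_fun (h1.unique ((hasFDerivAt_const (0 : Vec m) y).congr_of_eventuallyEq h2)) w

theorem hasFDerivAt_phi (h : StandingAssumptions U V A f g) {y : Aug n m}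
    (hy : y ∈ (univ : Set (Vec n)) ×ˢ V) : HasFDerivAt (phi g) (fderiv ℝ (phi g) y) y :=
  ((h.contDiffAt_phi hy).differentiableAt two_ne_zero).hasFDerivAt

theorem hasFDerivAt_phiInv (h : StandingAssumptions U V A f g) {y : Aug n m}
    (hy : y ∈ (univ : Set (Vec n)) ×ˢ V) :
    HasFDerivAt (phiInv g V) (fderiv ℝ (phiInv g V) (phi g y)) (phi g y) :=
  ((h.contDiffAt_phiInv hy).1.differentiableAt two_ne_zero).hasFDerivAt

theorem fderiv_phiInv_comp_fderiv_phi (h : StandingAssumptions U V A f g) {y : Aug n m}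
    (hy : y ∈ (univ : Set (Vec n)) ×ˢ V) :
    (fderiv ℝ (phiInv g V) (phi g y)).comp (fderiv ℝ (phi g) y) = ContinuousLinearMap.id ℝ _ := by
  have h1 := (h.hasFDerivAt_phiInv hy).comp y (h.hasFDerivAt_phi hy)
  refine h1.unique ((hasFDerivAt_id y).congr_of_eventuallyEq ?_)
  filter_upwards [h.isOpen_domain.mem_nhds hy] with y' hy' using h.phiInv_phi hy'

theorem contDiffAt_Ftilde (h : StandingAssumptions U V A f g) {a : Vec l} (ha : a ∈ A)
    {y : Aug n m} (hy : y ∈ (univ : Set (Vec n)) ×ˢ V) :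
    ContDiffAt ℝ 1 (fun q => Ftilde f g V q a) (phi g y) := by
  have h1 : ContDiffAt ℝ 1 (fun y' => (fderiv ℝ (phi g) y' (driftField f a y')).1) y :=
    contDiff_fst.contDiffAt.comp y
      ((h.contDiffOn_fderiv_phi.contDiffAt (h.isOpen_domain.mem_nhds hy)).clm_apply
        ((h.contDiffOn_driftField ha).contDiffAt (h.isOpen_domain.mem_nhds hy)))
  rw [← h.phiInv_phi hy] at h1
  exact h1.comp (phi g y) ((h.contDiffAt_phiInv hy).1.of_le one_le_two)

theorem transformedJacobian_eq (h : StandingAssumptions U V A f g) {a : Vec l} (ha : a ∈ A)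
    {y : Aug n m} (hy : y ∈ (univ : Set (Vec n)) ×ˢ V) :
    transformedJacobian f g V a y =
      (driftVariation f g a y).comp (fderiv ℝ (phiInv g V) (phi g y)) := by
  have h1 := hasFDerivAt_fst.comp y (h.hasFDerivAt_driftVariation ha hy)
  have h2 : HasFDerivAt (fun q => Ftilde f g V q a) _ (phi g y) :=
    HasFDerivAt.comp (g := Prod.fst ∘ fun y' => fderiv ℝ (phi g) y' (driftField f a y'))
      (f := phiInv g V) (phi g y) (by rw [h.phiInv_phi hy]; exact h1) (h.hasFDerivAt_phiInv hy)
  refine ContinuousLinearMap.ext fun w => ?_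
  rw [transformedJacobian, h2.fderiv]
  exact Prod.ext rfl (h.driftVariation_snd ha hy _).symm

theorem transformedJacobian_comp (h : StandingAssumptions U V A f g) {a : Vec l} (ha : a ∈ A)
    {y : Aug n m} (hy : y ∈ (univ : Set (Vec n)) ×ˢ V) :
    (transformedJacobian f g V a y).comp (fderiv ℝ (phi g) y) = driftVariation f g a y := by
  rw [h.transformedJacobian_eq ha hy, ContinuousLinearMap.comp_assoc,
    h.fderiv_phiInv_comp_fderiv_phi hy, ContinuousLinearMap.comp_id]

/-- The derivative of `∇φ` in the direction of the impulsive dynamics. -/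
theorem fderiv_fderiv_phi_dynamics (h : StandingAssumptions U V A f g) {a : Vec l} (ha : a ∈ A)
    {y : Aug n m} (hy : y ∈ (univ : Set (Vec n)) ×ˢ V) (v : Fin m → ℝ) :
    fderiv ℝ (fderiv ℝ (phi g)) y (driftField f a y + ∑ i, v i • gField g i y) =
      (transformedJacobian f g V a y).comp (fderiv ℝ (phi g) y) - (fderiv ℝ (phi g) y).comp
        (fderiv ℝ (driftField f a) y + ∑ i, v i • fderiv ℝ (gField g i) y) := by
  rw [h.transformedJacobian_comp ha hy]
  have hsymm : IsSymmSndFDerivAt ℝ (phi g) y :=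
    (h.contDiffAt_phi hy).isSymmSndFDerivAt (by simp)
  -- Differentiate the constant `∇φ · g_i` in the direction `w` and use the symmetry of the second
  -- derivative.
  have h1 : ∀ (i : Fin m) (w : Aug n m), fderiv ℝ (fderiv ℝ (phi g)) y (gField g i y) w =
      -fderiv ℝ (phi g) y (fderiv ℝ (gField g i) y w) := by
    intro i w
    rw [hsymm.eq]
    have h2 := (h.hasFDerivAt_fderiv_phi hy).clm_apply (h.hasFDerivAt_gField i hy)
    have h3 : (fun y' => fderiv ℝ (phi g) y' (gField g i y')) =ᶠ[𝓝 y]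
        fun _ => (0, EuclideanSpace.single i 1) := by
      filter_upwards [h.isOpen_domain.mem_nhds hy] with y' hy' using h.fderiv_phi_gField hy' i
    have h4 := DFunLike.congr_fun (h2.unique ((hasFDerivAt_const _ y).congr_of_eventuallyEq h3)) w
    exact eq_neg_of_add_eq_zero_right h4
  refine ContinuousLinearMap.ext fun w => ?_
  simp only [map_add, map_sum, map_smul, add_apply,
    sub_apply, ContinuousLinearMap.comp_apply, sum_apply,
    smul_apply, h1, driftVariation, ContinuousLinearMap.flip_apply, smul_neg,
    Finset.sum_neg_distrib]
  rw [hsymm.eq]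
  abel

theorem continuousOn_transformedJacobian (h : StandingAssumptions U V A f g) {a : Vec l}
    (ha : a ∈ A) : ContinuousOn (transformedJacobian f g V a) (univ ×ˢ V) := by
  intro y hy
  have h1 : ContinuousAt (fderiv ℝ fun q => Ftilde f g V q a) (phi g y) :=
    ((h.contDiffAt_Ftilde ha hy).fderiv_right (m := 0) (by norm_num)).continuousAt
  have h2 : ContinuousAt (fun y' => fderiv ℝ (fun q => Ftilde f g V q a) (phi g y')) y :=
    h1.comp (h.hasFDerivAt_phi hy).continuousAt
  have h3 : Continuous fun L : Aug n m →L[ℝ] Vec n => L.prod (0 : Aug n m →L[ℝ] Vec m) :=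
    ((ContinuousLinearMap.compL ℝ (Aug n m) (Vec n) (Aug n m))
      (ContinuousLinearMap.inl ℝ (Vec n) (Vec m))).continuous.congr fun L =>
        ContinuousLinearMap.ext fun w => rfl
  exact (h3.continuousAt.comp h2).continuousWithinAt

/-- Separate continuity becomes joint continuity because the local Lipschitz constant in `y` does
not depend on `a`. -/
theorem continuousOn_uncurry_drift (h : StandingAssumptions U V A f g) :
    ContinuousOn (Function.uncurry f) (((univ : Set (Vec n)) ×ˢ V) ×ˢ A) := by
  rintro ⟨y, a⟩ ⟨hy, ha⟩
  obtain ⟨L, N, hN, hL⟩ := h.f_lipschitz y hy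
  have h1 : ContinuousOn (Function.uncurry f) ((N ∩ univ ×ˢ V) ×ˢ A) :=
    continuousOn_prod_of_continuousOn_lipschitzOnWith _ L (fun y' hy' => h.f_continuous y' hy'.2)
      fun b hb => (hL b hb).mono inter_subset_left
  have hN' : N ∩ univ ×ˢ V ∈ 𝓝 y := inter_mem hN (h.isOpen_domain.mem_nhds hy)
  refine (h1 (y, a) ⟨mem_of_mem_nhds hN', ha⟩).mono_of_mem_nhdsWithin ?_
  rw [nhdsWithin_prod_eq]
  exact prod_mem_prod (mem_nhdsWithin_of_mem_nhds hN') self_mem_nhdsWithin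

theorem isOpen_image_phi (h : StandingAssumptions U V A f g) : IsOpen (phi g '' (univ ×ˢ V)) := by
  rw [isOpen_iff_mem_nhds]
  rintro _ ⟨y, hy, rfl⟩
  filter_upwards [(h.contDiffAt_phiInv hy).2] with q hq using ⟨_, hq.1, hq.2⟩

theorem continuousOn_uncurry_Ftilde (h : StandingAssumptions U V A f g) :
    ContinuousOn (Function.uncurry (Ftilde f g V)) ((phi g '' (univ ×ˢ V)) ×ˢ A) := by
  have h0 : MapsTo (phiInv g V) (phi g '' (univ ×ˢ V)) (univ ×ˢ V) := by
    rintro _ ⟨y, hy, rfl⟩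
    rwa [h.phiInv_phi hy]
  have h1 : ContinuousOn (phiInv g V) (phi g '' (univ ×ˢ V)) := by
    rintro _ ⟨y, hy, rfl⟩
    exact (h.hasFDerivAt_phiInv hy).continuousAt.continuousWithinAt
  have h2 : ContinuousOn (fun p : Aug n m × Vec l => phiInv g V p.1)
      ((phi g '' (univ ×ˢ V)) ×ˢ A) := h1.comp continuousOn_fst fun p hp => hp.1
  have h3 : ContinuousOn (fun p : Aug n m × Vec l => f (phiInv g V p.1) p.2)
      ((phi g '' (univ ×ˢ V)) ×ˢ A) :=
    h.continuousOn_uncurry_drift.comp (h2.prodMk continuousOn_snd) fun p hp => ⟨h0 hp.1, hp.2⟩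
  have h4 : ContinuousOn (fun p : Aug n m × Vec l => fderiv ℝ (phi g) (phiInv g V p.1))
      ((phi g '' (univ ×ˢ V)) ×ˢ A) :=
    h.contDiffOn_fderiv_phi.continuousOn.comp h2 fun p hp => h0 hp.1
  exact continuous_fst.comp_continuousOn (h4.clm_apply (h3.prodMk continuousOn_const))

theorem aestronglyMeasurable_transformedJacobian (h : StandingAssumptions U V A f g)
    {μ : Measure ℝ} {y : ℝ → Aug n m} {a : ℝ → Vec l} (hy : AEStronglyMeasurable y μ)
    (ha : AEStronglyMeasurable a μ) (hya : ∀ᵐ s ∂μ, y s ∈ (univ : Set (Vec n)) ×ˢ V ∧ a s ∈ A) :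
    AEStronglyMeasurable (fun s => transformedJacobian f g V (a s) (y s)) μ := by
  have hφ : AEMeasurable (fun s => phi g (y s)) μ :=
    (h.phi_contDiffOn.continuousOn.comp_aestronglyMeasurable_of_mem h.isOpen_domain hy
      (hya.mono fun _ hs => hs.1)).aemeasurable
  have h1 := aestronglyMeasurable_fderiv_param h.isOpen_image_phi h.isCompact_A.measurableSet
    h.continuousOn_uncurry_Ftilde (by
      rintro b hb _ ⟨y', hy', rfl⟩
      exact (h.contDiffAt_Ftilde hb hy').differentiableAt one_ne_zero) hφ ha.aemeasurable
    (by filter_upwards [hya] with s hs using ⟨mem_image_of_mem _ hs.1, hs.2⟩)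
  exact aestronglyMeasurable_clm_of_apply fun v =>
    ((h1.apply_continuousLinearMap v).prodMk aestronglyMeasurable_const)

theorem exists_bound_fderiv_drift (h : StandingAssumptions U V A f g) {S : Set (Aug n m)}
    (hS : IsCompact S) (hSV : S ⊆ univ ×ˢ V) :
    ∃ C, ∀ y ∈ S, ∀ a ∈ A, ‖fderiv ℝ (driftField f a) y‖ ≤ C := by
  refine hS.induction_on (p := fun S => ∃ C, ∀ y ∈ S, ∀ a ∈ A, ‖fderiv ℝ (driftField f a) y‖ ≤ C)
    ⟨0, by simp⟩ (fun s t hst ⟨C, hC⟩ => ⟨C, fun y hy => hC y (hst hy)⟩)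
    (fun s t ⟨C, hC⟩ ⟨C', hC'⟩ => ⟨max C C', ?_⟩) fun y hy => ?_
  · rintro y (hy | hy) a ha
    · exact (hC y hy a ha).trans (le_max_left _ _)
    · exact (hC' y hy a ha).trans (le_max_right _ _)
  · obtain ⟨L, N, hN, hL⟩ := h.f_lipschitz y (hSV hy)
    refine ⟨interior N, mem_nhdsWithin_of_mem_nhds (interior_mem_nhds.2 hN), L, fun y' hy' a ha => ?_⟩
    have h1 : LipschitzOnWith L (driftField f a) N := by
      refine LipschitzOnWith.of_dist_le_mul fun p hp q hq => ?_
      simp only [driftField, Prod.dist_eq, dist_self]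
      exact max_le ((hL a ha).dist_le_mul p hp q hq) (by positivity)
    exact norm_fderiv_le_of_lipschitzOn ℝ (mem_interior_iff_mem_nhds.1 hy') h1

/-- Uniformity in `a` comes from the Lipschitz constants for `∇f` and from linear growth for `f`.
The latter is assumed only over `U`, hence the condition on `S`; all other factors depend on `y`
alone and are continuous. -/
theorem exists_bound_transformedJacobian (h : StandingAssumptions U V A f g) {S : Set (Aug n m)}
    (hS : IsCompact S) (hSU : S ⊆ univ ×ˢ U) :
    ∃ C, ∀ y ∈ S, ∀ a ∈ A, ‖transformedJacobian f g V a y‖ ≤ C := by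
  have hSV : S ⊆ univ ×ˢ V := hSU.trans (prod_mono_right h.U_subset_V)
  obtain ⟨C₁, h1⟩ := h.exists_bound_fderiv_drift hS hSV
  obtain ⟨C₂, h2⟩ := hS.exists_bound_of_continuousOn
    (h.contDiffOn_fderiv_phi.continuousOn.mono hSV)
  obtain ⟨C₃, h3⟩ := hS.exists_bound_of_continuousOn
    ((h.contDiffOn_fderiv_phi.continuousOn_fderiv_of_isOpen h.isOpen_domain le_rfl).mono hSV)
  obtain ⟨C₄, h4⟩ := hS.exists_bound_of_continuousOn
    (f := fun y => fderiv ℝ (phiInv g V) (phi g y)) (fun y hy => by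
      have h5 : ContinuousAt (fderiv ℝ (phiInv g V)) (phi g y) :=
        ((h.contDiffAt_phiInv (hSV hy)).1.fderiv_right (m := 1) (by norm_num)).continuousAt
      exact (ContinuousAt.comp (f := phi g) h5
        (h.hasFDerivAt_phi (hSV hy)).continuousAt).continuousWithinAt)
  obtain ⟨C₅, h5⟩ := hS.exists_bound_of_continuousOn (continuousOn_id (s := S))
  obtain ⟨M, hM, h6⟩ := h.f_growth
  refine ⟨(C₂ * C₁ + C₃ * (M * (1 + C₅))) * C₄, fun y hy a ha => ?_⟩
  have hC₂ := (norm_nonneg _).trans (h2 y hy)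
  have hC₃ := (norm_nonneg _).trans (h3 y hy)
  have hC₁ := (norm_nonneg _).trans (h1 y hy a ha)
  have hC₅ := (norm_nonneg _).trans (h5 y hy)
  rw [h.transformedJacobian_eq ha (hSV hy)]
  refine (ContinuousLinearMap.opNorm_comp_le _ _).trans ?_
  refine mul_le_mul ?_ (h4 y hy) (norm_nonneg _) (by positivity)
  refine (norm_add_le _ _).trans (add_le_add ?_ ?_)
  · exact (ContinuousLinearMap.opNorm_comp_le _ _).trans
      (mul_le_mul (h2 y hy) (h1 y hy a ha) (norm_nonneg _) hC₂)
  · refine (ContinuousLinearMap.le_opNorm _ _).trans ?_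
    rw [ContinuousLinearMap.opNorm_flip]
    refine mul_le_mul (h3 y hy) ?_ (norm_nonneg _) hC₃
    have : ‖driftField f a y‖ = ‖f y a‖ := by simp [driftField, Prod.norm_def]
    rw [this]
    refine (h6 y (hSU hy) a ha).trans ?_
    gcongr
    exact h5 y hy

end StandingAssumptions

end TransformedDrift

/-! ### The adjoint equation in the new coordinates -/

section AdjointTransport

variable {n m l : ℕ} {T : ℝ} {U V : Set (Vec m)} {A : Set (Vec l)} {f : Aug n m → Vec l → Vec n}
  {g : Fin m → Aug n m → Vec n} {γ : Aug n m → ℝ} {x₀ : Vec n} {a : ℝ → Vec l}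

theorem continuousOn_of_eq_add_integral_left {E : Type*} [NormedAddCommGroup E] [NormedSpace ℝ E]
    {T : ℝ} (hT : 0 ≤ T) {q r : ℝ → E} (hr : IntervalIntegrable r volume 0 T) {e : E}
    (hq : ∀ t ∈ Icc 0 T, q t = e + ∫ s in t..T, r s) : ContinuousOn q (Icc 0 T) := by
  have h1 := intervalIntegral.continuousOn_primitive_interval_left (μ := volume) (f := r) (a := 0)
    (b := T) (by rwa [uIcc_of_le hT, ← intervalIntegrable_iff_integrableOn_Icc_of_le hT])
  rw [uIcc_of_le hT] at h1
  exact (continuousOn_const.add h1).congr hq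

theorem IsClassicalState.eq_add_integral (hT : 0 ≤ T) {w : ℝ → Vec m} {y : ℝ → Aug n m}
    (hy : IsClassicalState T f g x₀ w a y) :
    ∀ t ∈ Icc 0 T, y t = y 0 + ∫ s in (0 : ℝ)..t, stateRHS T f g w a y s := by
  intro t ht
  rw [hy.2 t ht, hy.2 0 ⟨le_rfl, hT⟩]
  simp

theorem IsClassicalState.continuousOn (hT : 0 ≤ T) {w : ℝ → Vec m} {y : ℝ → Aug n m}
    (hy : IsClassicalState T f g x₀ w a y) : ContinuousOn y (Icc 0 T) := by
  have h1 := intervalIntegral.continuousOn_primitive_interval' hy.1 (left_mem_uIcc)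
  rw [uIcc_of_le hT] at h1
  exact (continuousOn_const.add h1).congr hy.2

theorem IsClassicalState.snd_eq {w : ℝ → Vec m} {y : ℝ → Aug n m}
    (hw : IsC1Control T U w) (hy : IsClassicalState T f g x₀ w a y) :
    ∀ t ∈ Icc 0 T, (y t).2 = w t := by
  intro t ht
  have hT : 0 ≤ T := ht.1.trans ht.2
  have hsub : uIcc 0 t ⊆ uIcc 0 T := by
    rw [uIcc_of_le hT, uIcc_of_le ht.1]; exact Icc_subset_Icc_right ht.2
  -- For `T = 0` the interval has no unique derivatives, so this case is treated apart.
  rcases hT.eq_or_lt with rfl | hT'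
  · have : t = 0 := le_antisymm ht.2 ht.1
    subst this
    rw [hy.2 0 ht]
    simp
  have hd : ContinuousOn (derivWithin w (Icc 0 T)) (Icc 0 T) :=
    hw.1.continuousOn_derivWithin (uniqueDiffOn_Icc hT') le_rfl
  have h1 : (∫ s in (0 : ℝ)..t, stateRHS T f g w a y s).2 =
      ∫ s in (0 : ℝ)..t, (stateRHS T f g w a y s).2 :=
    ((ContinuousLinearMap.snd ℝ (Vec n) (Vec m)).intervalIntegral_comp_comm
      (hy.1.mono_set hsub)).symm
  have h2 : ∀ s, (stateRHS T f g w a y s).2 = derivWithin w (Icc 0 T) s := by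
    intro s
    have := controlField_snd g (derivWithin w (Icc 0 T) s) (y s)
    rw [controlField] at this
    rw [stateRHS, Prod.snd_add, this]
    simp [driftField]
  have h3 : ∫ s in (0 : ℝ)..t, derivWithin w (Icc 0 T) s = w t - w 0 := by
    refine intervalIntegral.integral_eq_sub_of_hasDeriv_right_of_le ht.1
      (hw.1.continuousOn.mono (Icc_subset_Icc_right ht.2)) (fun s hs => ?_)
      ((hd.mono (Icc_subset_Icc_right ht.2)).intervalIntegrable_of_Icc ht.1)
    have hs' : s ∈ Icc 0 T := ⟨hs.1.le, hs.2.le.trans ht.2⟩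
    exact (((hw.1.differentiableOn one_ne_zero) s hs').hasDerivWithinAt.hasDerivAt
      (Icc_mem_nhds hs.1 (hs.2.trans_le ht.2))).hasDerivWithinAt
  rw [hy.2 t ht, Prod.snd_add, h1]
  simp only [h2, h3, add_sub_cancel]

theorem IsClassicalState.mem_domain {w : ℝ → Vec m} {y : ℝ → Aug n m}
    (hw : IsC1Control T U w) (hy : IsClassicalState T f g x₀ w a y) :
    ∀ t ∈ Icc 0 T, y t ∈ (univ : Set (Vec n)) ×ˢ U := fun t ht =>
  ⟨trivial, by rw [hy.snd_eq hw t ht]; exact hw.2 ht⟩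

theorem IsClassicalAdjoint.continuousOn (hT : 0 ≤ T) {w : ℝ → Vec m} {y : ℝ → Aug n m}
    {q : ℝ → Row n m} (hq : IsClassicalAdjoint T f g γ w a y q) : ContinuousOn q (Icc 0 T) :=
  continuousOn_of_eq_add_integral_left hT hq.2.1 hq.2.2

namespace StandingAssumptions

theorem mem_domain_of_mem (h : StandingAssumptions U V A f g) {y : Aug n m}
    (hy : y ∈ (univ : Set (Vec n)) ×ˢ U) : y ∈ (univ : Set (Vec n)) ×ˢ V :=
  ⟨trivial, h.U_subset_V hy.2⟩

/-- The bound depends on `ẇ` and so is not uniform along an approximating sequence. It serves only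
for uniqueness of the adjoint of one fixed control. -/
theorem exists_bound_stateJacobian (h : StandingAssumptions U V A f g) (hT : 0 < T)
    (haA : ∀ t ∈ Icc 0 T, a t ∈ A) {w : ℝ → Vec m} {y : ℝ → Aug n m} (hw : IsC1Control T U w)
    (hy : IsClassicalState T f g x₀ w a y) :
    ∃ C, ∀ t ∈ Icc 0 T, ‖stateJacobian T f g w a y t‖ ≤ C := by
  have hyc := hy.continuousOn hT.le
  have hyV : MapsTo y (Icc 0 T) (univ ×ˢ V) := fun t ht => h.mem_domain_of_mem (hy.mem_domain hw t ht)
  obtain ⟨C₁, h1⟩ := h.exists_bound_fderiv_drift (isCompact_Icc.image_of_continuousOn hyc)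
    hyV.image_subset
  have hd : ContinuousOn (derivWithin w (Icc 0 T)) (Icc 0 T) :=
    hw.1.continuousOn_derivWithin (uniqueDiffOn_Icc hT) le_rfl
  have h2 : ContinuousOn (fun s => ∑ i, (derivWithin w (Icc 0 T) s) i •
      fderiv ℝ (gField g i) (y s)) (Icc 0 T) := by
    refine continuousOn_finsetSum _ fun i _ => ContinuousOn.fun_smul ?_ ?_
    · exact (EuclideanSpace.proj (𝕜 := ℝ) i).continuous.comp_continuousOn hd
    · exact ((h.contDiffOn_gField i).continuousOn_fderiv_of_isOpen h.isOpen_domain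
        one_le_two).comp hyc hyV
  obtain ⟨C₂, h3⟩ := isCompact_Icc.exists_bound_of_continuousOn h2
  exact ⟨C₁ + C₂, fun t ht => (norm_add_le _ _).trans
    (add_le_add (h1 _ (mem_image_of_mem y ht) _ (haA t ht)) (h3 t ht))⟩

theorem eqOn_of_isClassicalAdjoint (h : StandingAssumptions U V A f g) (hT : 0 < T)
    (haA : ∀ t ∈ Icc 0 T, a t ∈ A) {w : ℝ → Vec m} {y : ℝ → Aug n m} (hw : IsC1Control T U w)
    (hy : IsClassicalState T f g x₀ w a y) {q q' : ℝ → Row n m}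
    (hq : IsClassicalAdjoint T f g γ w a y q) (hq' : IsClassicalAdjoint T f g γ w a y q') :
    EqOn q q' (Icc 0 T) := by
  obtain ⟨C, hC⟩ := h.exists_bound_stateJacobian hT haA hw hy
  have hC0 : 0 ≤ C := (norm_nonneg _).trans (hC 0 ⟨le_rfl, hT.le⟩)
  have hqc := hq.continuousOn hT.le
  have hqc' := hq'.continuousOn hT.le
  have hc : ContinuousOn (fun t => ‖q t - q' t‖) (Icc 0 T) := (hqc.sub hqc').norm
  have h1 := le_mul_exp_of_le_add_integral (ε := 0) hT.le hC0 hc fun t ht => by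
    have hsub : uIcc t T ⊆ uIcc 0 T := by
      rw [uIcc_of_le hT.le, uIcc_of_le ht.2]; exact Icc_subset_Icc_left ht.1
    rw [hq.2.2 t ht, hq'.2.2 t ht, hq.1, hq'.1, add_sub_add_left_eq_sub,
      ← intervalIntegral.integral_sub (hq.2.1.mono_set hsub) (hq'.2.1.mono_set hsub), zero_add,
      ← intervalIntegral.integral_const_mul]
    refine intervalIntegral.norm_integral_le_of_norm_le ht.2 (ae_of_all _ fun s hs => ?_)
      ((continuousOn_const.mul (hc.mono (Icc_subset_Icc_left ht.1))).intervalIntegrable_of_Icc ht.2)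
    rw [← ContinuousLinearMap.sub_comp, mul_comm]
    exact (ContinuousLinearMap.opNorm_comp_le _ _).trans
      (by gcongr; exact hC s ⟨ht.1.trans hs.1.le, hs.2⟩)
  intro t ht
  have h2 := h1 t ht
  rw [zero_mul] at h2
  exact sub_eq_zero.1 (norm_le_zero_iff.1 h2)

theorem fderiv_comp_fderiv_phi (h : StandingAssumptions U V A f g) (p : Row n m × Aug n m)
    (hp : p.2 ∈ (univ : Set (Vec n)) ×ˢ V) (r : Row n m × Aug n m) :
    fderiv ℝ (fun p : Row n m × Aug n m => p.1.comp (fderiv ℝ (phi g) p.2)) p r =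
      p.1.comp (fderiv ℝ (fderiv ℝ (phi g)) p.2 r.2) + r.1.comp (fderiv ℝ (phi g) p.2) := by
  have h1 : HasFDerivAt (fun p : Row n m × Aug n m => p.1.comp (fderiv ℝ (phi g) p.2)) _ p :=
    (hasFDerivAt_fst (p := p)).clm_comp
      (HasFDerivAt.comp p (h.hasFDerivAt_fderiv_phi hp) (hasFDerivAt_snd (p := p)))
  rw [h1.fderiv]
  rfl

/-- Product rule for `p · ∇φ(y)`: the terms with the Jacobian of `F̃` cancel, leaving the right-hand
side of the adjoint equation, in which `ẇ` reappears through the derivative of `∇φ(y)`. -/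
theorem transported_derivative (h : StandingAssumptions U V A f g) {w : ℝ → Vec m}
    {y : ℝ → Aug n m} {s : ℝ} (has : a s ∈ A) (hys : y s ∈ (univ : Set (Vec n)) ×ˢ V)
    (p : Row n m) :
    fderiv ℝ (fun p : Row n m × Aug n m => p.1.comp (fderiv ℝ (phi g) p.2)) (p, y s)
      (-(p.comp (transformedJacobian f g V (a s) (y s))), stateRHS T f g w a y s) =
      -(p.comp (fderiv ℝ (phi g) (y s))).comp (stateJacobian T f g w a y s) := by
  have h0 : ∀ (M D J : Aug n m →L[ℝ] Aug n m),
      p.comp (M.comp D - D.comp J) + (-(p.comp M)).comp D = -(p.comp D).comp J := fun M D J =>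
    ContinuousLinearMap.ext fun v => by simp; ring
  rw [h.fderiv_comp_fderiv_phi _ hys, stateRHS, stateJacobian]
  dsimp only
  rw [h.fderiv_fderiv_phi_dynamics has hys]
  exact h0 _ _ _

theorem transported_eq_sub_integral (h : StandingAssumptions U V A f g) (hT : 0 ≤ T)
    (haA : ∀ t ∈ Icc 0 T, a t ∈ A) {w : ℝ → Vec m} {y : ℝ → Aug n m}
    (hy : IsClassicalState T f g x₀ w a y)
    (hyV : ∀ t ∈ Icc 0 T, y t ∈ (univ : Set (Vec n)) ×ˢ V) {π : ℝ → Row n m}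
    (hπi : IntervalIntegrable (fun s => (π s).comp (transformedJacobian f g V (a s) (y s))) volume 0 T)
    (hπ : ∀ t ∈ Icc 0 T, π t =
      π 0 + ∫ s in (0 : ℝ)..t, -(π s).comp (transformedJacobian f g V (a s) (y s))) :
    IntervalIntegrable (fun s => ((π s).comp (fderiv ℝ (phi g) (y s))).comp
      (stateJacobian T f g w a y s)) volume 0 T ∧
    ∀ t ∈ Icc 0 T, (π t).comp (fderiv ℝ (phi g) (y t)) = (π 0).comp (fderiv ℝ (phi g) (y 0)) -
      ∫ s in (0 : ℝ)..t, ((π s).comp (fderiv ℝ (phi g) (y s))).comp (stateJacobian T f g w a y s) := by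
  have hsub : ∀ t ∈ Icc 0 T, uIcc 0 t ⊆ uIcc 0 T := fun t ht => by
    rw [uIcc_of_le hT, uIcc_of_le ht.1]; exact Icc_subset_Icc_right ht.2
  have hR : IntervalIntegrable (fun s => ((-(π s).comp (transformedJacobian f g V (a s) (y s)),
      stateRHS T f g w a y s) : Row n m × Aug n m)) volume 0 T := by
    have h1 := hπi.neg
    have h2 := hy.1
    rw [intervalIntegrable_iff] at h1 h2 ⊢
    exact h1.prodMk h2
  have hpair : ∀ t ∈ Icc 0 T, (π t, y t) = (π 0, y 0) + ∫ s in (0 : ℝ)..t,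
      ((-(π s).comp (transformedJacobian f g V (a s) (y s)), stateRHS T f g w a y s) :
        Row n m × Aug n m) := by
    intro t ht
    refine Prod.ext ((hπ t ht).trans ?_) ((hy.eq_add_integral hT t ht).trans ?_)
    · exact congrArg (fun b => π 0 + b) ((ContinuousLinearMap.fst ℝ (Row n m)
        (Aug n m)).intervalIntegral_comp_comm (hR.mono_set (hsub t ht)))
    · exact congrArg (fun b => y 0 + b) ((ContinuousLinearMap.snd ℝ (Row n m)
        (Aug n m)).intervalIntegral_comp_comm (hR.mono_set (hsub t ht)))
  have hΦ : ContDiffOn ℝ 1 (fun p : Row n m × Aug n m => p.1.comp (fderiv ℝ (phi g) p.2))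
      (univ ×ˢ (univ ×ˢ V)) :=
    contDiff_fst.contDiffOn.clm_comp (h.contDiffOn_fderiv_phi.comp contDiff_snd.contDiffOn
      fun p hp => hp.2)
  -- The chain rule is applied to the pair `(π, y)`, where `∇φ` is only `C¹` and `y` only absolutely
  -- continuous.
  obtain ⟨hi, he⟩ := comp_eq_add_integral (isOpen_univ.prod h.isOpen_domain) hΦ hT
    (y := fun s => (π s, y s)) hR hpair (fun t ht => ⟨trivial, hyV t ht⟩)
  refine ⟨hi.neg.congr fun s hs => ?_, fun t ht => (he t ht).trans ?_⟩
  · rw [uIoc_of_le hT] at hs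
    simp only [Pi.neg_apply]
    rw [h.transported_derivative (haA s (Ioc_subset_Icc_self hs)) (hyV s (Ioc_subset_Icc_self hs)),
      neg_neg]
  · rw [sub_eq_add_neg, ← intervalIntegral.integral_neg]
    refine congrArg _ (intervalIntegral.integral_congr fun s hs => ?_)
    rw [uIcc_of_le ht.1] at hs
    have hs' : s ∈ Icc 0 T := ⟨hs.1, hs.2.trans ht.2⟩
    exact h.transported_derivative (haA s hs') (hyV s hs') (π s)

/-- The adjoint variable, transported back from the new coordinates, is a classical adjoint. -/
theorem isClassicalAdjoint_comp_fderiv_phi (h : StandingAssumptions U V A f g) (hT : 0 ≤ T)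
    (haA : ∀ t ∈ Icc 0 T, a t ∈ A) (hγ : ContDiff ℝ 1 γ) {w : ℝ → Vec m} {y : ℝ → Aug n m}
    (hw : IsC1Control T U w) (hy : IsClassicalState T f g x₀ w a y) {π : ℝ → Row n m}
    (hπT : π T = fderiv ℝ (fun q => γ (phiInv g V q)) (phi g (y T)))
    (hπi : IntervalIntegrable (fun s => (π s).comp (transformedJacobian f g V (a s) (y s))) volume 0 T)
    (hπ : ∀ t ∈ Icc 0 T, π t =
      π T + ∫ s in t..T, (π s).comp (transformedJacobian f g V (a s) (y s))) :
    IsClassicalAdjoint T f g γ w a y (fun s => (π s).comp (fderiv ℝ (phi g) (y s))) := by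
  have hyV : ∀ t ∈ Icc 0 T, y t ∈ (univ : Set (Vec n)) ×ˢ V :=
    fun t ht => h.mem_domain_of_mem (hy.mem_domain hw t ht)
  have hTT : T ∈ Icc 0 T := ⟨hT, le_rfl⟩
  have h00 : (0 : ℝ) ∈ Icc 0 T := ⟨le_rfl, hT⟩
  have hsub : ∀ t ∈ Icc 0 T, uIcc 0 t ⊆ uIcc 0 T := fun t ht => by
    rw [uIcc_of_le hT, uIcc_of_le ht.1]; exact Icc_subset_Icc_right ht.2
  have hsub' : ∀ t ∈ Icc 0 T, uIcc t T ⊆ uIcc 0 T := fun t ht => by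
    rw [uIcc_of_le hT, uIcc_of_le ht.2]; exact Icc_subset_Icc_left ht.1
  have hπ' : ∀ t ∈ Icc 0 T, π t =
      π 0 + ∫ s in (0 : ℝ)..t, -(π s).comp (transformedJacobian f g V (a s) (y s)) := by
    intro t ht
    rw [hπ t ht, hπ 0 h00, intervalIntegral.integral_neg,
      ← intervalIntegral.integral_add_adjacent_intervals (hπi.mono_set (hsub t ht))
        (hπi.mono_set (hsub' t ht))]
    abel
  obtain ⟨hi, he⟩ := h.transported_eq_sub_integral hT haA hy hyV hπi hπ'
  refine ⟨?_, hi, fun t ht => ?_⟩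
  -- Terminal condition: `∇Ψ · ∇φ = ∇γ · ∇φ⁻¹ · ∇φ = ∇γ`.
  · have hD : phiInv g V (phi g (y T)) = y T := h.phiInv_phi (hyV T hTT)
    have h1 : HasFDerivAt (fun q => γ (phiInv g V q)) _ (phi g (y T)) :=
      HasFDerivAt.comp (g := γ) (phi g (y T)) (by
        rw [hD]; exact (hγ.differentiable one_ne_zero (y T)).hasFDerivAt)
        (h.hasFDerivAt_phiInv (hyV T hTT))
    beta_reduce
    rw [hπT, h1.fderiv, ContinuousLinearMap.comp_assoc, h.fderiv_phiInv_comp_fderiv_phi (hyV T hTT),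
      ContinuousLinearMap.comp_id]
  · beta_reduce
    rw [he t ht, he T hTT, ← intervalIntegral.integral_add_adjacent_intervals
      (hi.mono_set (hsub t ht)) (hi.mono_set (hsub' t ht))]
    abel

theorem exists_transformedAdjoint (h : StandingAssumptions U V A f g) (hT : 0 < T)
    (ha : IntegrableOn a (Icc 0 T)) (haA : ∀ t ∈ Icc 0 T, a t ∈ A) {y : ℝ → Aug n m}
    (hy : ContinuousOn y (Icc 0 T)) (hyU : ∀ t ∈ Icc 0 T, y t ∈ (univ : Set (Vec n)) ×ˢ U)
    (e : Row n m) : ∃ π : ℝ → Row n m, Continuous π ∧ π T = e ∧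
      IntervalIntegrable (fun s => (π s).comp (transformedJacobian f g V (a s) (y s))) volume 0 T ∧
      ∀ t ∈ Icc 0 T, π t = π T + ∫ s in t..T, (π s).comp (transformedJacobian f g V (a s) (y s)) := by
  obtain ⟨C, hC⟩ := h.exists_bound_transformedJacobian (isCompact_Icc.image_of_continuousOn hy)
    (image_subset_iff.2 hyU)
  have hM := h.aestronglyMeasurable_transformedJacobian (μ := volume.restrict (Icc 0 T))
    (hy.aestronglyMeasurable measurableSet_Icc) ha.1
    ((ae_restrict_mem measurableSet_Icc).mono fun s hs => ⟨h.mem_domain_of_mem (hyU s hs), haA s hs⟩)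
  -- Right multiplication by a Jacobian, viewed as an operator on row vectors, does not increase its
  -- norm.
  let κ := (ContinuousLinearMap.compL ℝ (Aug n m) (Aug n m) ℝ).flip
  have hκ : ∀ s ∈ Icc 0 T, ‖κ (transformedJacobian f g V (a s) (y s))‖ ≤ C := fun s hs => by
    have hs' := hC _ (mem_image_of_mem y hs) _ (haA s hs)
    refine ContinuousLinearMap.opNorm_le_bound _ ((norm_nonneg _).trans hs') fun q => ?_
    rw [mul_comm]
    exact (ContinuousLinearMap.opNorm_comp_le _ _).trans (by gcongr)
  have hKm := κ.continuous.comp_aestronglyMeasurable hM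
  obtain ⟨π, hπc, hπ⟩ := exists_backward_linear_solution hT.le hKm hκ e
  have hπT : π T = e := by simpa using hπ T ⟨hT.le, le_rfl⟩
  refine ⟨π, hπc, hπT, ?_, fun t ht => hπT ▸ hπ t ht⟩
  rw [intervalIntegrable_iff_integrableOn_Icc_of_le hT.le]
  obtain ⟨B, hB⟩ := isCompact_Icc.exists_bound_of_continuousOn (s := Icc 0 T) hπc.continuousOn
  refine Integrable.of_bound
    ((ContinuousLinearMap.compL ℝ (Aug n m) (Aug n m) ℝ).aestronglyMeasurable_comp₂
      hπc.aestronglyMeasurable hM) (B * C) ?_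
  filter_upwards [ae_restrict_mem measurableSet_Icc] with s hs
  exact (ContinuousLinearMap.opNorm_comp_le _ _).trans
    (mul_le_mul (hB s hs) (hC _ (mem_image_of_mem y hs) _ (haA s hs)) (norm_nonneg _)
      ((norm_nonneg _).trans (hB s hs)))

/-- The transformed adjoint equation, for the full row vector `(π₁, π₂)`. -/
theorem row_of_isTransformedAdjoint (h : StandingAssumptions U V A f g) (hT : 0 < T)
    (haA : ∀ t ∈ Icc 0 T, a t ∈ A) {z : ℝ → Aug n m}
    (hz : ∀ t ∈ Icc 0 T, z t ∈ (univ : Set (Vec n)) ×ˢ V) {ξ : ℝ → Vec n} {η : ℝ → Vec m}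
    (hξη : ∀ t ∈ Icc 0 T, (ξ t, η t) = phi g (z t)) {π₁ : ℝ → (Vec n →L[ℝ] ℝ)}
    {π₂ : ℝ → (Vec m →L[ℝ] ℝ)} (hπ : IsTransformedAdjoint T V f g γ a ξ η π₁ π₂) :
    (π₁ T).coprod (π₂ T) = fderiv ℝ (fun q => γ (phiInv g V q)) (phi g (z T)) ∧
    IntervalIntegrable (fun s => ((π₁ s).coprod (π₂ s)).comp
      (transformedJacobian f g V (a s) (z s))) volume 0 T ∧
    ∀ t ∈ Icc 0 T, (π₁ t).coprod (π₂ t) = (π₁ T).coprod (π₂ T) +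
      ∫ s in t..T, ((π₁ s).coprod (π₂ s)).comp (transformedJacobian f g V (a s) (z s)) := by
  obtain ⟨hT1, hi1, hi2, he1, he2⟩ := hπ
  let L₁ := (ContinuousLinearMap.compL ℝ (Aug n m) (Vec n) ℝ).flip
    (ContinuousLinearMap.fst ℝ (Vec n) (Vec m))
  let L₂ := (ContinuousLinearMap.compL ℝ (Aug n m) (Vec m) ℝ).flip
    (ContinuousLinearMap.snd ℝ (Vec n) (Vec m))
  have hcop : ∀ (p : Vec n →L[ℝ] ℝ) (q : Vec m →L[ℝ] ℝ), p.coprod q = L₁ p + L₂ q := fun p q =>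
    ContinuousLinearMap.ext fun w => by simp [L₁, L₂]
  -- The transformed drift has zero second component, so `π₂` does not contribute; the total
  -- derivative of `F̃` splits into its two partial derivatives.
  have hpt : ∀ s ∈ Icc 0 T, ((π₁ s).coprod (π₂ s)).comp (transformedJacobian f g V (a s) (z s)) =
      L₁ ((π₁ s).comp (fderiv ℝ (fun ξ' => Ftilde f g V (ξ', η s) (a s)) (ξ s))) +
      L₂ ((π₁ s).comp (fderiv ℝ (fun η' => Ftilde f g V (ξ s, η') (a s)) (η s))) := by
    intro s hs
    have h1 : HasFDerivAt (fun q => Ftilde f g V q (a s))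
        (fderiv ℝ (fun q => Ftilde f g V q (a s)) (phi g (z s))) (ξ s, η s) := by
      rw [hξη s hs]
      exact ((h.contDiffAt_Ftilde (haA s hs) (hz s hs)).differentiableAt one_ne_zero).hasFDerivAt
    have h2 : HasFDerivAt (fun ξ' => Ftilde f g V (ξ', η s) (a s)) _ (ξ s) :=
      HasFDerivAt.comp (g := fun q => Ftilde f g V q (a s)) (ξ s) h1 (hasFDerivAt_prodMk_left (ξ s) (η s))
    have h3 : HasFDerivAt (fun η' => Ftilde f g V (ξ s, η') (a s)) _ (η s) :=
      HasFDerivAt.comp (g := fun q => Ftilde f g V q (a s)) (η s) h1 (hasFDerivAt_prodMk_right (ξ s) (η s))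
    refine ContinuousLinearMap.ext fun w => ?_
    rw [h2.fderiv, h3.fderiv]
    simp only [transformedJacobian, L₁, L₂, ContinuousLinearMap.comp_apply,
      ContinuousLinearMap.coprod_apply, ContinuousLinearMap.prod_apply, add_apply,
      ContinuousLinearMap.flip_apply, ContinuousLinearMap.compL_apply, zero_apply, map_zero,
      add_zero, ContinuousLinearMap.inl_apply, ContinuousLinearMap.inr_apply,
      ContinuousLinearMap.coe_fst', ContinuousLinearMap.coe_snd']
    rw [← map_add, ← map_add, Prod.mk_add_mk, add_zero, zero_add]
  have hL1 : IntervalIntegrable (fun s => L₁ ((π₁ s).comp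
      (fderiv ℝ (fun ξ' => Ftilde f g V (ξ', η s) (a s)) (ξ s)))) volume 0 T := by
    rw [intervalIntegrable_iff] at hi1 ⊢
    exact L₁.integrable_comp hi1
  have hL2 : IntervalIntegrable (fun s => L₂ ((π₁ s).comp
      (fderiv ℝ (fun η' => Ftilde f g V (ξ s, η') (a s)) (η s)))) volume 0 T := by
    rw [intervalIntegrable_iff] at hi2 ⊢
    exact L₂.integrable_comp hi2
  refine ⟨?_, (hL1.add hL2).congr fun s hs => ?_, fun t ht => ?_⟩
  · rw [hT1, hξη T ⟨hT.le, le_rfl⟩]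
  · rw [uIoc_of_le hT.le] at hs
    exact (hpt s (Ioc_subset_Icc_self hs)).symm
  · have hsub : uIcc t T ⊆ uIcc 0 T := by
      rw [uIcc_of_le hT.le, uIcc_of_le ht.2]; exact Icc_subset_Icc_left ht.1
    rw [intervalIntegral.integral_congr (g := fun s =>
      L₁ ((π₁ s).comp (fderiv ℝ (fun ξ' => Ftilde f g V (ξ', η s) (a s)) (ξ s))) +
      L₂ ((π₁ s).comp (fderiv ℝ (fun η' => Ftilde f g V (ξ s, η') (a s)) (η s)))) (fun s hs => by
        rw [uIcc_of_le ht.2] at hs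
        exact hpt s ⟨ht.1.trans hs.1, hs.2⟩),
      intervalIntegral.integral_add (hL1.mono_set hsub) (hL2.mono_set hsub),
      L₁.intervalIntegral_comp_comm (hi1.mono_set hsub),
      L₂.intervalIntegral_comp_comm (hi2.mono_set hsub), hcop, hcop, he1 t ht, he2 t ht, map_add,
      map_add]
    abel

end StandingAssumptions

end AdjointTransport

/-! ### Passage to the limit -/

section Limit

theorem TendstoL1On.tendstoInMeasure {E : Type*} [NormedAddCommGroup E] {T : ℝ} {I : Set ℝ}
    {v : ℕ → ℝ → E} {v' : ℝ → E} (hv : TendstoL1On T I v v')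
    (hm : ∀ k, AEStronglyMeasurable (v k) (volume.restrict (Icc 0 T))) :
    TendstoInMeasure (volume.restrict (Icc 0 T)) v atTop v' := by
  refine tendstoInMeasure_of_tendsto_eLpNorm one_ne_zero hm hv.1.1 ?_
  simp only [eLpNorm_one_eq_lintegral_enorm, Pi.sub_apply]
  exact hv.2.1

theorem TendstoL1On.ae_mem_of_isClosed {E : Type*} [NormedAddCommGroup E] {T : ℝ} {I : Set ℝ}
    {v : ℕ → ℝ → E} {v' : ℝ → E} (hv : TendstoL1On T I v v')
    (hm : ∀ k, AEStronglyMeasurable (v k) (volume.restrict (Icc 0 T))) {S : Set E}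
    (hS : IsClosed S) (hvS : ∀ k, ∀ t ∈ Icc 0 T, v k t ∈ S) :
    ∀ᵐ t ∂volume.restrict (Icc 0 T), v' t ∈ S := by
  obtain ⟨ns, -, hns⟩ := (hv.tendstoInMeasure hm).exists_seq_tendsto_ae
  filter_upwards [hns, ae_restrict_mem measurableSet_Icc] with t ht htI
  exact hS.mem_of_tendsto ht (Eventually.of_forall fun k => hvS _ t htI)

theorem TendstoL1On.congr {E : Type*} [NormedAddCommGroup E] {T : ℝ} {I : Set ℝ}
    {v : ℕ → ℝ → E} {v' v'' : ℝ → E} (hv : TendstoL1On T I v v')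
    (hI : ∀ t ∈ I, v'' t = v' t) (hae : ∀ᵐ t ∂volume.restrict (Icc 0 T), v'' t = v' t) :
    TendstoL1On T I v v'' := by
  refine ⟨hv.1.congr (hae.mono fun t ht => ht.symm), ?_, fun t ht => hI t ht ▸ hv.2.2 t ht⟩
  refine hv.2.1.congr fun k => lintegral_congr_ae (hae.mono fun t ht => ?_)
  simp only [ht]

theorem TendstoL1On.congr_left {E : Type*} [NormedAddCommGroup E] {T : ℝ} {I : Set ℝ}
    {v w : ℕ → ℝ → E} {v' : ℝ → E} (hv : TendstoL1On T I v v') (hI : I ⊆ Icc 0 T)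
    (hvw : ∀ k, EqOn (v k) (w k) (Icc 0 T)) : TendstoL1On T I w v' := by
  refine ⟨hv.1, hv.2.1.congr fun k => setLIntegral_congr_fun measurableSet_Icc fun t ht => ?_,
    fun t ht => (hv.2.2 t ht).congr fun k => hvw k (hI ht)⟩
  simp only [hvw k ht]

theorem TendstoL1On.ae_unique {E : Type*} [NormedAddCommGroup E] {T : ℝ} {I : Set ℝ}
    {v : ℕ → ℝ → E} {v' v'' : ℝ → E} (hv : TendstoL1On T I v v') (hv' : TendstoL1On T I v v'')
    (hm : ∀ k, AEStronglyMeasurable (v k) (volume.restrict (Icc 0 T))) :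
    ∀ᵐ t ∂volume.restrict (Icc 0 T), v' t = v'' t := by
  exact tendstoInMeasure_ae_unique (hv.tendstoInMeasure hm) (hv'.tendstoInMeasure hm)

variable {E : Type*} [NormedAddCommGroup E] [NormedSpace ℝ E]

/-- Continuous dependence of linear backward equations on the coefficients, in `L¹`. -/
theorem norm_sub_le_of_eq_add_integral_comp {T C B : ℝ} (hT : 0 ≤ T)
    {M M' : ℝ → E →L[ℝ] E} (hM : IntegrableOn M (Icc 0 T)) (hM' : IntegrableOn M' (Icc 0 T))
    (hC : ∀ t ∈ Icc 0 T, ‖M t‖ ≤ C) {π π' : ℝ → E →L[ℝ] ℝ}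
    (hπi : IntervalIntegrable (fun s => (π s).comp (M s)) volume 0 T)
    (hπi' : IntervalIntegrable (fun s => (π' s).comp (M' s)) volume 0 T)
    (hπ : ∀ t ∈ Icc 0 T, π t = π T + ∫ s in t..T, (π s).comp (M s))
    (hπ' : ∀ t ∈ Icc 0 T, π' t = π' T + ∫ s in t..T, (π' s).comp (M' s))
    (hB : ∀ t ∈ Icc 0 T, ‖π' t‖ ≤ B) :
    ∀ t ∈ Icc 0 T, ‖π t - π' t‖ ≤
      (‖π T - π' T‖ + B * ∫ s in Icc 0 T, ‖M s - M' s‖) * Real.exp (C * T) := by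
  have hTT : T ∈ Icc 0 T := ⟨hT, le_rfl⟩
  have hC0 : 0 ≤ C := (norm_nonneg _).trans (hC T hTT)
  have hB0 : 0 ≤ B := (norm_nonneg _).trans (hB T hTT)
  have hc : ContinuousOn (fun t => ‖π t - π' t‖) (Icc 0 T) :=
    ((continuousOn_of_eq_add_integral_left hT hπi hπ).sub
      (continuousOn_of_eq_add_integral_left hT hπi' hπ')).norm
  have hd : IntegrableOn (fun s => ‖M s - M' s‖) (Icc 0 T) := (hM.sub hM').norm
  have hd0 : 0 ≤ ∫ s in Icc 0 T, ‖M s - M' s‖ := integral_nonneg fun s => norm_nonneg _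
  have h1 := le_mul_exp_of_le_add_integral (ε := ‖π T - π' T‖ + B * ∫ s in Icc 0 T, ‖M s - M' s‖)
    hT hC0 hc fun t ht => by
      have hsub : uIcc t T ⊆ uIcc 0 T := by
        rw [uIcc_of_le hT, uIcc_of_le ht.2]; exact Icc_subset_Icc_left ht.1
      have hd' : IntervalIntegrable (fun s => ‖M s - M' s‖) volume t T :=
        ((intervalIntegrable_iff_integrableOn_Icc_of_le hT).2 hd).mono_set hsub
      have hc' : IntervalIntegrable (fun t => ‖π t - π' t‖) volume t T :=
        (hc.mono (Icc_subset_Icc_left ht.1)).intervalIntegrable_of_Icc ht.2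
      have h2 : ‖∫ s in t..T, ((π s).comp (M s) - (π' s).comp (M' s))‖ ≤
          ∫ s in t..T, (C * ‖π s - π' s‖ + B * ‖M s - M' s‖) := by
        refine intervalIntegral.norm_integral_le_of_norm_le ht.2 (ae_of_all _ fun s hs => ?_)
          ((hc'.const_mul C).add (hd'.const_mul B))
        have hs' : s ∈ Icc 0 T := ⟨ht.1.trans hs.1.le, hs.2⟩
        -- Split so that only `M` needs a pointwise bound; `M'`, the coefficient along the limit, is
        -- controlled just through `M - M'` in `L¹`.
        have h3 : (π s).comp (M s) - (π' s).comp (M' s) =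
            (π s - π' s).comp (M s) + (π' s).comp (M s - M' s) := by
          simp
        rw [h3, mul_comm C]
        refine (norm_add_le _ _).trans (add_le_add ?_ ?_)
        · exact (ContinuousLinearMap.opNorm_comp_le _ _).trans (by gcongr; exact hC s hs')
        · exact (ContinuousLinearMap.opNorm_comp_le _ _).trans (by gcongr; exact hB s hs')
      have h4 : ∫ s in t..T, ‖M s - M' s‖ ≤ ∫ s in Icc 0 T, ‖M s - M' s‖ := by
        rw [intervalIntegral.integral_of_le ht.2]
        exact setIntegral_mono_set hd (ae_of_all _ fun s => norm_nonneg _)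
          (Eventually.of_forall fun s hs => ⟨ht.1.trans hs.1.le, hs.2⟩)
      rw [intervalIntegral.integral_add (hc'.const_mul C) (hd'.const_mul B),
        intervalIntegral.integral_const_mul, intervalIntegral.integral_const_mul] at h2
      rw [hπ t ht, hπ' t ht, add_sub_add_comm,
        ← intervalIntegral.integral_sub (hπi.mono_set hsub) (hπi'.mono_set hsub)]
      have h5 := norm_add_le (π T - π' T) (∫ s in t..T, ((π s).comp (M s) - (π' s).comp (M' s)))
      have h6 := mul_le_mul_of_nonneg_left h4 hB0
      linarith
  intro t ht
  refine (h1 t ht).trans ?_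
  gcongr
  linarith [ht.1]

/-- Uniform convergence of `π k` absorbs the bounded factor `D k`, so the product inherits exactly
the kind of convergence that `D k` has. -/
theorem tendstoL1On_clm_comp {T B C : ℝ} {I : Set ℝ} (hI : I ⊆ Icc 0 T)
    {D : ℕ → ℝ → E →L[ℝ] E} {D' : ℝ → E →L[ℝ] E} (hD : TendstoL1On T I D D')
    (hC : ∀ k, ∀ t ∈ Icc 0 T, ‖D k t‖ ≤ C) {π : ℕ → ℝ → E →L[ℝ] ℝ} {π' : ℝ → E →L[ℝ] ℝ}
    (hπc : ContinuousOn π' (Icc 0 T)) (hB : ∀ t ∈ Icc 0 T, ‖π' t‖ ≤ B) {δ : ℕ → ℝ}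
    (hδ : Tendsto δ atTop (𝓝 0)) (hπ : ∀ k, ∀ t ∈ Icc 0 T, ‖π k t - π' t‖ ≤ δ k) :
    TendstoL1On T I (fun k t => (π k t).comp (D k t)) (fun t => (π' t).comp (D' t)) := by
  have hle : ∀ k, ∀ t ∈ Icc 0 T, ‖(π k t).comp (D k t) - (π' t).comp (D' t)‖ ≤
      δ k * C + B * ‖D k t - D' t‖ := fun k t ht => by
    have h3 : (π k t).comp (D k t) - (π' t).comp (D' t) =
        (π k t - π' t).comp (D k t) + (π' t).comp (D k t - D' t) := by
      simp
    rw [h3]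
    refine (norm_add_le _ _).trans (add_le_add ?_ ?_)
    · exact (ContinuousLinearMap.opNorm_comp_le _ _).trans
        (mul_le_mul (hπ k t ht) (hC k t ht) (norm_nonneg _) ((norm_nonneg _).trans (hπ k t ht)))
    · exact (ContinuousLinearMap.opNorm_comp_le _ _).trans (by gcongr; exact hB t ht)
  have hδC : Tendsto (fun k => δ k * C) atTop (𝓝 0) := by simpa using hδ.mul_const C
  refine ⟨?_, ?_, fun t ht => ?_⟩
  · refine Integrable.mono' (hD.1.norm.const_mul B)
      ((ContinuousLinearMap.compL ℝ E E ℝ).aestronglyMeasurable_comp₂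
        (hπc.aestronglyMeasurable measurableSet_Icc) hD.1.1) ?_
    filter_upwards [ae_restrict_mem measurableSet_Icc] with t ht
    exact (ContinuousLinearMap.opNorm_comp_le _ _).trans (by gcongr; exact hB t ht)
  · have hup : ∀ k, ∫⁻ t in Icc 0 T, ‖(π k t).comp (D k t) - (π' t).comp (D' t)‖ₑ ≤
        ENNReal.ofReal (δ k * C) * volume (Icc 0 T) +
          ENNReal.ofReal B * ∫⁻ t in Icc 0 T, ‖D k t - D' t‖ₑ := fun k => by
      rw [← setLIntegral_const, ← lintegral_const_mul' _ _ ENNReal.ofReal_ne_top,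
        ← lintegral_add_left measurable_const]
      refine setLIntegral_mono' measurableSet_Icc fun t ht => ?_
      have hB0 : 0 ≤ B := (norm_nonneg _).trans (hB t ht)
      rw [← ofReal_norm, ← ofReal_norm, ← ENNReal.ofReal_mul hB0]
      exact (ENNReal.ofReal_le_ofReal (hle k t ht)).trans ENNReal.ofReal_add_le
    refine tendsto_of_tendsto_of_tendsto_of_le_of_le tendsto_const_nhds ?_ (fun k => zero_le) hup
    have h1 : Tendsto (fun k => ENNReal.ofReal (δ k * C) * volume (Icc 0 T)) atTop (𝓝 0) := by
      have := ENNReal.Tendsto.mul_const (b := volume (Icc 0 T)) (ENNReal.tendsto_ofReal hδC)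
        (Or.inr measure_Icc_lt_top.ne)
      simpa using this
    have h2 := ENNReal.Tendsto.const_mul (a := ENNReal.ofReal B) hD.2.1
      (Or.inr ENNReal.ofReal_ne_top)
    simpa using h1.add h2
  · rw [tendsto_iff_norm_sub_tendsto_zero]
    refine squeeze_zero (fun k => norm_nonneg _) (fun k => hle k t (hI ht)) ?_
    have h1 := (tendsto_iff_norm_sub_tendsto_zero.1 (hD.2.2 t ht)).const_mul B
    simpa using hδC.add h1

end Limit

/-! ### Generalized adjoints as limits of transported classical adjoints -/

section GeneralizedAdjoint

variable {n m l : ℕ} {T : ℝ} {U V : Set (Vec m)} {A : Set (Vec l)} {f : Aug n m → Vec l → Vec n}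
  {g : Fin m → Aug n m → Vec n} {γ : Aug n m → ℝ} {x₀ : Vec n} {a : ℝ → Vec l}

namespace StandingAssumptions

/-- A closed ball intersected with the closed set `ℝⁿ × U` works. Limits are caught only on `I` and
almost everywhere: elsewhere the values of `z` are unrelated to the sequence. -/
theorem exists_isCompact_mem (h : StandingAssumptions U V A f g) (hT : 0 ≤ T) {I : Set ℝ}
    (hI : I ⊆ Icc 0 T) {w : ℕ → ℝ → Vec m} {y : ℕ → ℝ → Aug n m} {z : ℝ → Aug n m}
    (hw : ∀ k, IsC1Control T U (w k)) (hy : ∀ k, IsClassicalState T f g x₀ (w k) a (y k))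
    (hyb : UniformlyBounded T y) (hyz : TendstoL1On T I y z) :
    ∃ S : Set (Aug n m), IsCompact S ∧ S ⊆ univ ×ˢ U ∧ (∀ k, ∀ t ∈ Icc 0 T, y k t ∈ S) ∧
      (∀ t ∈ I, z t ∈ S) ∧ ∀ᵐ t ∂volume.restrict (Icc 0 T), z t ∈ S := by
  obtain ⟨C, hC⟩ := hyb
  have hU : IsClosed U := by
    obtain ⟨W, -, -, rfl⟩ := h.closure_U
    exact isClosed_closure
  have hS : IsCompact (Metric.closedBall (0 : Aug n m) C ∩ univ ×ˢ U) :=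
    (isCompact_closedBall _ _).inter_right (isClosed_univ.prod hU)
  have hyS : ∀ k, ∀ t ∈ Icc 0 T, y k t ∈ Metric.closedBall (0 : Aug n m) C ∩ univ ×ˢ U :=
    fun k t ht => ⟨mem_closedBall_zero_iff.2 (hC k t ht), (hy k).mem_domain (hw k) t ht⟩
  exact ⟨_, hS, inter_subset_right, hyS,
    fun t ht => hS.isClosed.mem_of_tendsto (hyz.2.2 t ht)
      (Eventually.of_forall fun k => hyS k t (hI ht)),
    hyz.ae_mem_of_isClosed (fun k => ((hy k).continuousOn hT).aestronglyMeasurable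
      measurableSet_Icc) hS.isClosed hyS⟩

/-- Along every approximating sequence of trajectories, the classical adjoints converge to the
adjoint variable of the limit, transported back from the new coordinates. -/
theorem exists_adjoint_approximation (h : StandingAssumptions U V A f g) (hT : 0 < T)
    (ha : IntegrableOn a (Icc 0 T)) (haA : ∀ t ∈ Icc 0 T, a t ∈ A) (hγ : ContDiff ℝ 1 γ)
    {I : Set ℝ} (hI : I ⊆ Icc 0 T) (hTI : T ∈ I) {w : ℕ → ℝ → Vec m} {y : ℕ → ℝ → Aug n m}
    {z : ℝ → Aug n m} (hw : ∀ k, IsC1Control T U (w k))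
    (hy : ∀ k, IsClassicalState T f g x₀ (w k) a (y k)) (hyb : UniformlyBounded T y)
    (hyz : TendstoL1On T I y z) (hzV : ∀ t ∈ Icc 0 T, z t ∈ (univ : Set (Vec n)) ×ˢ V)
    {π : ℝ → Row n m} (hπT : π T = fderiv ℝ (fun q => γ (phiInv g V q)) (phi g (z T)))
    (hπi : IntervalIntegrable (fun s => (π s).comp (transformedJacobian f g V (a s) (z s)))
      volume 0 T)
    (hπ : ∀ t ∈ Icc 0 T, π t =
      π T + ∫ s in t..T, (π s).comp (transformedJacobian f g V (a s) (z s))) :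
    ∃ q : ℕ → ℝ → Row n m, (∀ k, IsClassicalAdjoint T f g γ (w k) a (y k) (q k)) ∧
      UniformlyBounded T q ∧
      TendstoL1On T I q (fun t => (π t).comp (fderiv ℝ (phi g) (z t))) := by
  have hTT : T ∈ Icc 0 T := ⟨hT.le, le_rfl⟩
  obtain ⟨S, hS, hSU, hyS, hzI, hzS⟩ := h.exists_isCompact_mem hT.le hI hw hy hyb hyz
  have hSV : S ⊆ (univ : Set (Vec n)) ×ˢ V := fun q hq => h.mem_domain_of_mem (hSU hq)
  have hyc : ∀ k, ContinuousOn (y k) (Icc 0 T) := fun k => (hy k).continuousOn hT.le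
  have hym : ∀ k, AEStronglyMeasurable (y k) (volume.restrict (Icc 0 T)) :=
    fun k => (hyc k).aestronglyMeasurable measurableSet_Icc
  have hmem : ∀ᵐ t ∂volume.restrict (Icc 0 T), t ∈ Icc 0 T := ae_restrict_mem measurableSet_Icc
  have hyS' : ∀ᵐ t ∂volume.restrict (Icc 0 T), ∀ k, y k t ∈ S :=
    hmem.mono fun t ht k => hyS k t ht
  -- convergence of the coefficients
  obtain ⟨C, hC⟩ := h.exists_bound_transformedJacobian hS hSU
  have hMy : ∀ k, AEStronglyMeasurable (fun t => transformedJacobian f g V (a t) (y k t))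
      (volume.restrict (Icc 0 T)) := fun k =>
    h.aestronglyMeasurable_transformedJacobian (hym k) ha.1
      (hmem.mono fun t ht => ⟨hSV (hyS k t ht), haA t ht⟩)
  have hMz : AEStronglyMeasurable (fun t => transformedJacobian f g V (a t) (z t))
      (volume.restrict (Icc 0 T)) :=
    h.aestronglyMeasurable_transformedJacobian hyz.1.1 ha.1
      (hmem.mono fun t ht => ⟨hzV t ht, haA t ht⟩)
  have hM := tendsto_lintegral_enorm_comp_sub hym hyz.1.1 hyz.2.1 hyS' hzS
    (H := fun t => transformedJacobian f g V (a t)) (C := C)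
    (hmem.mono fun t ht => (h.continuousOn_transformedJacobian (haA t ht)).mono hSV)
    (hmem.mono fun t ht q hq => hC q hq (a t) (haA t ht)) hMy hMz
  have hMyi : ∀ k, IntegrableOn (fun t => transformedJacobian f g V (a t) (y k t)) (Icc 0 T) :=
    fun k => Integrable.of_bound (hMy k) C
      (hmem.mono fun t ht => hC _ (hyS k t ht) _ (haA t ht))
  have hMzi : IntegrableOn (fun t => transformedJacobian f g V (a t) (z t)) (Icc 0 T) :=
    Integrable.of_bound hMz C ((hmem.and hzS).mono fun t ht => hC _ ht.2 _ (haA t ht.1))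
  -- convergence of the Jacobians of the change of coordinates
  have hDc : ContinuousOn (fderiv ℝ (phi g)) ((univ : Set (Vec n)) ×ˢ V) :=
    h.contDiffOn_fderiv_phi.continuousOn
  obtain ⟨C', hC'⟩ := hS.exists_bound_of_continuousOn (hDc.mono hSV)
  have hDz : AEStronglyMeasurable (fun t => fderiv ℝ (phi g) (z t))
      (volume.restrict (Icc 0 T)) :=
    hDc.comp_aestronglyMeasurable_of_mem h.isOpen_domain hyz.1.1 (hmem.mono hzV)
  have hD : TendstoL1On T I (fun k t => fderiv ℝ (phi g) (y k t))
      (fun t => fderiv ℝ (phi g) (z t)) := by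
    refine ⟨Integrable.of_bound hDz C' (hzS.mono fun t ht => hC' _ ht), ?_, fun t ht =>
      ((hDc.continuousAt (h.isOpen_domain.mem_nhds (hzV t (hI ht)))).tendsto.comp
        (hyz.2.2 t ht))⟩
    exact tendsto_lintegral_enorm_comp_sub hym hyz.1.1 hyz.2.1 hyS' hzS
      (H := fun _ => fderiv ℝ (phi g)) (C := C') (ae_of_all _ fun t => hDc.mono hSV)
      (ae_of_all _ fun t => hC') (fun k => hDc.comp_aestronglyMeasurable_of_mem h.isOpen_domain
        (hym k) (hmem.mono fun t ht => hSV (hyS k t ht))) hDz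
  -- the adjoint variables in the new coordinates
  choose P hPc hPT hPi hP using fun k => h.exists_transformedAdjoint hT ha haA (hyc k)
    (fun t ht => hSU (hyS k t ht))
    (fderiv ℝ (fun q => γ (phiInv g V q)) (phi g (y k T)))
  have hπc := continuousOn_of_eq_add_integral_left hT.le hπi hπ
  obtain ⟨B, hB⟩ := isCompact_Icc.exists_bound_of_continuousOn hπc
  have hB0 : 0 ≤ B := (norm_nonneg _).trans (hB T hTT)
  have hPTlim : Tendsto (fun k => P k T) atTop (𝓝 (π T)) := by
    have hzT := hzV T hTT
    have h1 : ContDiffAt ℝ 1 (fun q => γ (phiInv g V q)) (phi g (z T)) :=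
      hγ.contDiffAt.comp (phi g (z T)) ((h.contDiffAt_phiInv hzT).1.of_le one_le_two)
    have h2 : ContinuousAt (fderiv ℝ (fun q => γ (phiInv g V q))) (phi g (z T)) :=
      (h1.fderiv_right (m := 0) (by norm_num)).continuousAt
    have h3 : ContinuousAt (phi g) (z T) :=
      h.phi_contDiffOn.continuousOn.continuousAt (h.isOpen_domain.mem_nhds hzT)
    simp only [hPT, hπT]
    exact h2.tendsto.comp (h3.tendsto.comp (hyz.2.2 T hTI))
  -- The bound of `norm_sub_le_of_eq_add_integral_comp`. It tends to zero because the terminal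
  -- values converge, by `T ∈ I`, and the coefficients converge in `L¹`.
  let δ : ℕ → ℝ := fun k => (‖P k T - π T‖ + B * ∫ s in Icc 0 T,
    ‖transformedJacobian f g V (a s) (y k s) - transformedJacobian f g V (a s) (z s)‖) *
      Real.exp (C * T)
  have hδ : Tendsto δ atTop (𝓝 0) := by
    have h1 := tendsto_iff_norm_sub_tendsto_zero.1 hPTlim
    have h2 : Tendsto (fun k => ∫ s in Icc 0 T, ‖transformedJacobian f g V (a s) (y k s) -
        transformedJacobian f g V (a s) (z s)‖) atTop (𝓝 0) := by
      have h3 := (ENNReal.tendsto_toReal ENNReal.zero_ne_top).comp hM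
      rw [ENNReal.toReal_zero] at h3
      exact h3.congr fun k => (integral_norm_eq_lintegral_enorm ((hMy k).sub hMz)).symm
    simpa using (h1.add (h2.const_mul B)).mul_const (Real.exp (C * T))
  have hPδ : ∀ k, ∀ t ∈ Icc 0 T, ‖P k t - π t‖ ≤ δ k := fun k =>
    norm_sub_le_of_eq_add_integral_comp hT.le (hMyi k) hMzi
      (fun t ht => hC _ (hyS k t ht) _ (haA t ht)) (hPi k) hπi (hP k) hπ hB
  refine ⟨fun k t => (P k t).comp (fderiv ℝ (phi g) (y k t)), fun k =>
    h.isClassicalAdjoint_comp_fderiv_phi hT.le haA hγ (hw k) (hy k) (hPT k) (hPi k) (hP k), ?_,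
    tendstoL1On_clm_comp hI hD (fun k t ht => hC' _ (hyS k t ht)) hπc hB hδ hPδ⟩
  obtain ⟨K, hK⟩ := hδ.bddAbove_range
  refine ⟨(K + B) * C', fun k t ht => (ContinuousLinearMap.opNorm_comp_le _ _).trans ?_⟩
  have h1 : ‖P k t‖ ≤ K + B := by
    have h2 := norm_add_le (P k t - π t) (π t)
    rw [sub_add_cancel] at h2
    linarith [hPδ k t ht, hK (mem_range_self k), hB t ht]
  exact mul_le_mul h1 (hC' _ (hyS k t ht)) (norm_nonneg _) ((norm_nonneg _).trans h1)

/-- Uniqueness of classical adjoints forces any approximating adjoints to be the transported ones,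
so their limit is determined. Conversely, any sequence approximating `x` carries such adjoints. -/
theorem isGeneralizedAdjoint_iff (h : StandingAssumptions U V A f g) (hT : 0 < T)
    (ha : IntegrableOn a (Icc 0 T)) (haA : ∀ t ∈ Icc 0 T, a t ∈ A) (hγ : ContDiff ℝ 1 γ)
    {u : ℝ → Vec m} {x : ℝ → Vec n} (huU : ∀ t ∈ Icc 0 T, u t ∈ U)
    {π : ℝ → Row n m} (hπT : π T = fderiv ℝ (fun q => γ (phiInv g V q)) (phi g (x T, u T)))
    (hπi : IntervalIntegrable (fun s => (π s).comp (transformedJacobian f g V (a s) (x s, u s)))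
      volume 0 T)
    (hπ : ∀ t ∈ Icc 0 T, π t =
      π T + ∫ s in t..T, (π s).comp (transformedJacobian f g V (a s) (x s, u s)))
    {I : Set ℝ} (hI : I ⊆ Icc 0 T) (hTI : T ∈ I)
    (hx : IsGeneralizedSolution T I U f g x₀ u a x) (p : ℝ → Row n m) :
    IsGeneralizedAdjoint T I U f g γ x₀ u a x p ↔
      (∀ t ∈ I, p t = (π t).comp (fderiv ℝ (phi g) (x t, u t))) ∧
      ∀ᵐ t ∂volume.restrict (Icc 0 T), p t = (π t).comp (fderiv ℝ (phi g) (x t, u t)) := by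
  have hzV : ∀ t ∈ Icc 0 T, (x t, u t) ∈ (univ : Set (Vec n)) ×ˢ V :=
    fun t ht => ⟨trivial, h.U_subset_V (huU t ht)⟩
  constructor
  · rintro ⟨w, y, q, hw, hy, hq, hyb, -, hyz, hqp⟩
    obtain ⟨q', hq', -, hqp'⟩ := h.exists_adjoint_approximation hT ha haA hγ hI hTI hw hy hyb hyz
      hzV hπT hπi hπ
    have hqp'' := hqp'.congr_left (w := q) hI fun k =>
      h.eqOn_of_isClassicalAdjoint hT haA (hw k) (hy k) (hq' k) (hq k)
    exact ⟨fun t ht => tendsto_nhds_unique (hqp.2.2 t ht) (hqp''.2.2 t ht),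
      hqp.ae_unique hqp'' fun k =>
        ((hq k).continuousOn hT.le).aestronglyMeasurable measurableSet_Icc⟩
  · rintro ⟨hpI, hpae⟩
    obtain ⟨w, y, hw, hy, hyb, hyz⟩ := hx
    obtain ⟨q, hq, hqb, hqp⟩ := h.exists_adjoint_approximation hT ha haA hγ hI hTI hw hy hyb hyz
      hzV hπT hπi hπ
    exact ⟨w, y, q, hw, hy, hq, hyb, hqb, hyz, hqp.congr hpI hpae⟩

end StandingAssumptions

end GeneralizedAdjoint

end


theorem mainTheorem8 {n m l : ℕ} (T : ℝ) (hT : 0 < T)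
    (U V : Set (Vec m)) (A : Set (Vec l))
    (f : Aug n m → Vec l → Vec n) (g : Fin m → Aug n m → Vec n)
    (hfg : StandingAssumptions U V A f g)
    (γ : Aug n m → ℝ) (hγ : ContDiff ℝ 1 γ)
    (x₀ : Vec n) (u : ℝ → Vec m) (a : ℝ → Vec l) (x : ℝ → Vec n)
    (hu : IntegrableOn u (Icc 0 T)) (huU : ∀ t ∈ Icc 0 T, u t ∈ U)
    (ha : IntegrableOn a (Icc 0 T)) (haA : ∀ t ∈ Icc 0 T, a t ∈ A)
    (ξ : ℝ → Vec n) (η : ℝ → Vec m)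
    (hξη : ∀ t ∈ Icc 0 T, (ξ t, η t) = phi g (x t, u t))
    (π₁ : ℝ → (Vec n →L[ℝ] ℝ)) (π₂ : ℝ → (Vec m →L[ℝ] ℝ))
    (hπ : IsTransformedAdjoint T V f g γ a ξ η π₁ π₂) :
    (IsGeneralizedSolutionEverywhere T U f g x₀ u a x →
      ∀ p : ℝ → Row n m,
        IsGeneralizedAdjointEverywhere T U f g γ x₀ u a x p ↔
          ∀ t ∈ Icc 0 T, p t = ((π₁ t).coprod (π₂ t)).comp (fderiv ℝ (phi g) (x t, u t))) ∧
    (∀ I ⊆ Icc 0 T, 0 ∈ I → T ∈ I →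
      IsGeneralizedSolution T I U f g x₀ u a x →
      ∀ p : ℝ → Row n m,
        IsGeneralizedAdjoint T I U f g γ x₀ u a x p ↔
          (∀ t ∈ I, p t = ((π₁ t).coprod (π₂ t)).comp (fderiv ℝ (phi g) (x t, u t))) ∧
          (∀ᵐ t ∂(volume.restrict (Icc 0 T)),
            p t = ((π₁ t).coprod (π₂ t)).comp (fderiv ℝ (phi g) (x t, u t)))) := by
  obtain ⟨hπT, hπi, hπ'⟩ := hfg.row_of_isTransformedAdjoint hT haA
    (z := fun t => (x t, u t)) (fun t ht => ⟨trivial, hfg.U_subset_V (huU t ht)⟩) hξη hπ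
  have hiff : ∀ I ⊆ Icc 0 T, T ∈ I → IsGeneralizedSolution T I U f g x₀ u a x →
      ∀ p : ℝ → Row n m, IsGeneralizedAdjoint T I U f g γ x₀ u a x p ↔ _ :=
    fun I hI hTI hx p =>
      hfg.isGeneralizedAdjoint_iff hT ha haA hγ huU hπT hπi hπ' hI hTI hx p
  have hsub : ∀ τ ∈ Icc 0 T, ({0, τ, T} : Set ℝ) ⊆ Icc 0 T := by
    rintro τ hτ t (rfl | rfl | rfl)
    exacts [⟨le_rfl, hT.le⟩, hτ, ⟨hT.le, le_rfl⟩]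
  -- For the everywhere version take `I = {0, τ, T}`. The formula at `t` is read off with `τ = t`;
  -- although the sequences vary with `τ`, the limit formula does not. Conversely, equality on all
  -- of `[0, T]` gives both the pointwise and the almost everywhere condition for each `τ`.
  refine ⟨fun hx p => ⟨fun hp t ht => ?_, fun hp τ hτ => ?_⟩, fun I hI _ hTI hx p =>
    hiff I hI hTI hx p⟩
  · exact ((hiff _ (hsub t ht) (by simp) (hx t ht) p).1 (hp t ht)).1 t (by simp)
  · exact (hiff _ (hsub τ hτ) (by simp) (hx τ hτ) p).2
      ⟨fun t ht => hp t (hsub τ hτ ht), (ae_restrict_mem measurableSet_Icc).mono hp⟩
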